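/- **Definitions.** Let $X$ be a set. The near symmetric group $\mathfrak S^\star(X)$ is the group, under composition, of bijections between cofinite subsets of $X$, where two such partial bijections are identified when they coincide on a cofinite subset of $X$. A *near $G$-set* is a set $X$ with a group homomorphism $\alpha:G\to\mathfrak S^\star(X)$. A subset $Y\subseteq X$ is *$G$-commensurated* if for every $g\in G$ and every partial bijection $\tilde g$ representing $\alpha(g)$, only finitely many $x\in Y$ in the domain of $\tilde g$ satisfy $\tilde g x\notin Y$. The near $G$-set $X$ *has finitely many ends* if there are only finitely many $G$-commensurated subsets of $X$ up to finite symmetric difference. Let $G$ be finitely generated. For a finite generating subset $S$ of $G$, choose for each $s\in S$ a lift $\bar s$ of $\alpha(s)$, that is, a relation $\bar s\subseteq X\times X$ which differs by finitely many pairs from the graph of a cofinite partial bijection representing $\alpha(s)$ (for instance such a partial bijection itself, or a self-map of $X$ coinciding with it on a cofinite subset). The corresponding *near Schreier graph* has vertex set $X$, two distinct points $x,y$ being adjacent if $(x,y)\in\bar s$ or $(y,x)\in\bar s$ for some $s\in S$. The near $G$-set $X$ is *of finite type* if some (equivalently, every) near Schreier graph has finitely many connected components. A *key fob completion* of a near Schreier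 graph is a connected graph obtained from it by adding finitely many edges. The growth function of a connected graph $\mathcal K$ based at a vertex $x_0$ is $b_{\mathcal K,x_0}(n)=\#\{y: d_{\mathcal K}(x_0,y)\le n\}$. For functions $b,c$ on $\mathbf N$, write $b\preceq c$ if there is an integer $C\ge 1$ such that $b(n)\le C\,c(Cn)+C$ for all $n\in\mathbf N$. The growth function $b_{G,T}$ of $G$ with respect to a finite generating subset $T$ is the growth function, based at $1$, of the Cayley graph in which two distinct elements $x,y$ are adjacent if $y=sx$ or $x=sy$ for some $s\in T$. **Theorem.** Let $G$ be a finitely generated virtually abelian group (that is, $G$ has an abelian subgroup of finite index), and let $X$ be a near $G$-set of finite type. Then 1. $X$ has finitely many ends; 2. $X$ grows asymptotically no faster than $G$: for every key fob completion $\mathcal K$ of every near Schreier graph of $X$, every $x_0\in X$ and every finite generating subset $T$ of $G$, one has $b_{\mathcal K,x_0}\preceq b_{G,T}$. -/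

import Mathlib

open scoped symmDiff

/-- A partial bijection of `X` is cofinite when its domain and its range are cofinite. -/
def IsCofinitePartialBij {X : Type*} (f : X ≃. X) : Prop :=
  {x | f x = none}.Finite ∧ {y | f.symm y = none}.Finite

/-- Bijections from a cofinite subset of `X` onto a cofinite subset of `X`. -/
abbrev CofinitePartialBij (X : Type*) : Type _ := {f : X ≃. X // IsCofinitePartialBij f}

namespace CofinitePartialBij

variable {X : Type*}

/-- The image of a finite set under a partial bijection is finite. -/
theorem finite_image (f : X ≃. X) {F : Set X} (hF : F.Finite) :
    {y | ∃ x ∈ F, f x = some y}.Finite := by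
  refine ((hF.image f).preimage (Option.some_injective X).injOn).subset ?_
  rintro y ⟨x, hx, hxy⟩
  exact ⟨x, hx, hxy⟩

/-- The preimage of a finite set under a partial bijection is finite. -/
theorem finite_preimage (f : X ≃. X) {F : Set X} (hF : F.Finite) :
    {x | ∃ y ∈ F, f x = some y}.Finite := by
  refine (finite_image f.symm hF).subset ?_
  rintro x ⟨y, hy, hxy⟩
  exact ⟨y, hy, f.eq_some_iff.2 hxy⟩

/-- Two cofinite partial bijections are identified when they coincide on a cofinite subset. -/
instance nearEqSetoid (X : Type*) : Setoid (CofinitePartialBij X) where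
  r f g := {x | f.1 x ≠ g.1 x}.Finite
  iseqv :=
    { refl := fun f => by simp
      symm := fun {f g} h => by simpa only [ne_comm] using h
      trans := fun {f g k} h₁ h₂ => (h₁.union h₂).subset fun x hx => by
        by_contra hn
        simp only [Set.mem_union, Set.mem_ofPred_eq, not_or, not_not] at hn
        exact hx (hn.1.trans hn.2) }

/-- The composition `f ∘ g`. -/
def comp (f g : CofinitePartialBij X) : CofinitePartialBij X :=
  ⟨g.1.trans f.1, by
    have key : ∀ f g : X ≃. X, {x | f x = none}.Finite → {x | g x = none}.Finite →
        {x | (g.trans f) x = none}.Finite := by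
      intro f g hf hg
      refine (hg.union (finite_preimage g hf)).subset ?_
      intro x hx
      rcases hgx : g x with _ | y
      · exact Or.inl hgx
      · refine Or.inr ⟨y, ?_, hgx⟩
        have hx' : (g x).bind f = none := hx
        simpa [hgx] using hx'
    exact ⟨key _ _ f.2.1 g.2.1, key _ _ g.2.2 f.2.2⟩⟩

/-- The identity. -/
def id (X : Type*) : CofinitePartialBij X := ⟨PEquiv.refl X, by
  constructor <;> simp [PEquiv.refl_apply, PEquiv.symm_refl]⟩

/-- The inverse partial bijection. -/
def inv (f : CofinitePartialBij X) : CofinitePartialBij X := ⟨f.1.symm, f.2.2, f.2.1⟩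

theorem comp_congr {f f' g g' : CofinitePartialBij X} (hf : f ≈ f') (hg : g ≈ g') :
    comp f g ≈ comp f' g' := by
  refine (hg.union (finite_preimage g.1 hf)).subset ?_
  intro x hx
  by_contra hn
  simp only [Set.mem_union, Set.mem_ofPred_eq, not_or, not_not, not_exists, not_and] at hn
  apply hx
  change (g.1 x).bind f.1 = (g'.1 x).bind f'.1
  rw [← hn.1]
  rcases hgx : g.1 x with _ | y
  · rfl
  · by_contra hne
    exact hn.2 y hne hgx

theorem inv_congr {f g : CofinitePartialBij X} (h : f ≈ g) : inv f ≈ inv g := by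
  refine ((f.2.2.union g.2.2).union (finite_image f.1 h)).subset ?_
  intro y hy
  rcases hfy : f.1.symm y with _ | x
  · exact Or.inl (Or.inl hfy)
  · refine Or.inr ⟨x, ?_, f.1.eq_some_iff.1 hfy⟩
    intro hx
    apply hy
    change f.1.symm y = g.1.symm y
    rw [hfy, eq_comm, g.1.eq_some_iff, ← hx, ← f.1.eq_some_iff, hfy]

theorem inv_comp (f : CofinitePartialBij X) : comp (inv f) f ≈ id X := by
  refine f.2.1.subset ?_
  intro x hx
  by_contra hn
  obtain ⟨y, hy⟩ := Option.ne_none_iff_exists'.1 hn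
  apply hx
  change (f.1 x).bind f.1.symm = some x
  rw [hy]
  exact f.1.eq_some_iff.2 hy

end CofinitePartialBij

/-- The near symmetric group of `X`: bijections between cofinite subsets of `X`, two of them being
identified when they coincide on a cofinite subset. -/
def NearPerm (X : Type*) : Type _ := Quotient (CofinitePartialBij.nearEqSetoid X)

/-- The near permutation represented by a cofinite partial bijection. -/
def NearPerm.mk {X : Type*} (f : CofinitePartialBij X) : NearPerm X := Quotient.mk _ f

/-- The group law is induced by composition: `mk f * mk g = mk (f ∘ g)`. -/
instance NearPerm.instGroup (X : Type*) : Group (NearPerm X) :=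
  letI : Mul (NearPerm X) := ⟨Quotient.map₂ CofinitePartialBij.comp
    fun _ _ hf _ _ hg => CofinitePartialBij.comp_congr hf hg⟩
  letI : One (NearPerm X) := ⟨NearPerm.mk (CofinitePartialBij.id X)⟩
  letI : Inv (NearPerm X) := ⟨Quotient.map CofinitePartialBij.inv
    fun _ _ h => CofinitePartialBij.inv_congr h⟩
  Group.ofLeftAxioms
    (by
      rintro ⟨a⟩ ⟨b⟩ ⟨c⟩
      exact congrArg NearPerm.mk (Subtype.ext (PEquiv.trans_assoc c.1 b.1 a.1).symm))
    (by
      rintro ⟨a⟩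
      exact congrArg NearPerm.mk (Subtype.ext (PEquiv.trans_refl a.1)))
    (by
      rintro ⟨a⟩
      exact Quotient.sound (CofinitePartialBij.inv_comp a))

/-- A near action of the group `G` on the set `X`. -/
abbrev NearAction (G X : Type*) [Group G] : Type _ := G →* NearPerm X

namespace NearAction

variable {G X : Type*} [Group G]

/-- `Y ⊆ X` is `G`-commensurated: for every `g` and every representative `f` of `g`, only finitely
many points of `Y` are sent by `f` outside `Y`. -/
def IsCommensurated (α : NearAction G X) (Y : Set X) : Prop :=
  ∀ (g : G) (f : CofinitePartialBij X), NearPerm.mk f = α g →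
    {x | x ∈ Y ∧ ∃ y, f.1 x = some y ∧ y ∉ Y}.Finite

/-- Near equality of commensurated subsets: the symmetric difference is finite. -/
def commensuratedSetoid (α : NearAction G X) : Setoid {Y : Set X // α.IsCommensurated Y} where
  r Y Z := (Y.1 ∆ Z.1).Finite
  iseqv :=
    { refl := fun Y => by simp
      symm := fun {Y Z} h => by simpa only [symmDiff_comm] using h
      trans := fun {Y Z W} h₁ h₂ => (h₁.union h₂).subset (symmDiff_triangle Y.1 Z.1 W.1) }

/-- The set of ends is finite: there are finitely many commensurated subsets up to near equality. -/
def IsFinitelyEnded (α : NearAction G X) : Prop := Finite (Quotient α.commensuratedSetoid)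

/-- A relation `R` on `X` is a lift of the near permutation `σ` if it differs in finitely many
pairs from the graph of a cofinite partial bijection representing `σ`. In particular every
representative of `σ`, and every self-map of `X` which coincides with one on a cofinite subset of
`X`, is a lift. -/
def IsLift (R : X → X → Prop) (σ : NearPerm X) : Prop :=
  ∃ f : CofinitePartialBij X, NearPerm.mk f = σ ∧
    {p : X × X | ¬ (R p.1 p.2 ↔ f.1 p.1 = some p.2)}.Finite

/-- `Γ` is a near Schreier graph of `α`: for a finite generating subset `S` of `G` and a lift `R s`
of each `s ∈ S`, two distinct points `x`, `y` are adjacent if and only if one of them is sent to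
the other by one of these lifts. -/
def IsNearSchreierGraph (α : NearAction G X) (Γ : SimpleGraph X) : Prop :=
  ∃ (S : Finset G) (R : G → X → X → Prop), Subgroup.closure (S : Set G) = ⊤ ∧
    (∀ s ∈ S, IsLift (R s) (α s)) ∧ Γ = SimpleGraph.fromRel (fun x y => ∃ s ∈ S, R s x y)

/-- Finite type: some near Schreier graph has finitely many connected components. -/
def IsFiniteType (α : NearAction G X) : Prop :=
  ∃ Γ : SimpleGraph X, α.IsNearSchreierGraph Γ ∧ Finite Γ.ConnectedComponent

end NearAction

/-- A key fob completion of `Γ`: a connected graph obtained by adding finitely many edges. -/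
def SimpleGraph.IsKeyFobCompletion {X : Type*} (Γ K : SimpleGraph X) : Prop :=
  Γ ≤ K ∧ (K.edgeSet \ Γ.edgeSet).Finite ∧ K.Connected

/-- The number of vertices at distance at most `n` from `x₀`. -/
noncomputable def SimpleGraph.growthFunction {X : Type*} (K : SimpleGraph X) (x₀ : X) (n : ℕ) :
    ℕ∞ :=
  {y | K.edist x₀ y ≤ n}.encard

/-- The growth functions of a near `G`-set: those of the key fob completions of its near Schreier
graphs, for all choices of base points. -/
def NearAction.IsGrowthFunction {G X : Type*} [Group G] (α : NearAction G X) (b : ℕ → ℕ∞) : Prop :=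
  ∃ (Γ K : SimpleGraph X) (x₀ : X), α.IsNearSchreierGraph Γ ∧ Γ.IsKeyFobCompletion K ∧
    b = K.growthFunction x₀

/-- The Schreier graph, for the finite generating subset `T`, of `G` acting on itself by left
translations. -/
def leftCayleyGraph {G : Type*} [Group G] (T : Finset G) : SimpleGraph G :=
  SimpleGraph.fromRel (fun x y => ∃ s ∈ T, s * x = y)

/-- The growth functions of the group `G`: those of its Cayley graphs for finite generating
subsets, based at `1`. -/
def IsGroupGrowthFunction (G : Type*) [Group G] (b : ℕ → ℕ∞) : Prop :=
  ∃ T : Finset G, Subgroup.closure (T : Set G) = ⊤ ∧ b = (leftCayleyGraph T).growthFunction 1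

/-- `b` is asymptotically bounded above by `c`. -/
def AsympBoundedBy (b c : ℕ → ℕ∞) : Prop :=
  ∃ C : ℕ, 1 ≤ C ∧ ∀ n : ℕ, b n ≤ C * c (C * n) + C

/-- A group with an abelian subgroup of finite index. -/
def IsVirtuallyAbelian (G : Type*) [Group G] : Prop :=
  ∃ A : Subgroup G, A.FiniteIndex ∧ ∀ a ∈ A, ∀ b ∈ A, a * b = b * a

open scoped symmDiff Pointwise IsMulCommutative

open Filter

/-! Let `A` be an abelian subgroup of finite index. Schreier rewriting turns paths in a graph of `G`
into paths for finitely many generators of `A`, so it is enough to study near actions of `A` in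
which every point leads to a finite hub (`IsLiftFamily.exists_nearSystem`).

Fix a finite set outside which the generators commute and cancel exactly. A forward orbit of a
generator that avoids this set is periodic or leaves every finite set. Only finitely many points
escape under no generator (`finite_forall_notMem_escapeSet`): up to finitely many, such points are
periodic under all generators with uniform periods, so a finite-index subgroup almost fixes them,
and almost each of them would generate a finite closed set missing the hub.

By commutation, `A` acts on the germs at infinity of escaping `s`-orbits, and every germ is carried
to that of one of finitely many base points (`exists_germRel_base`). A commensurated set eventually
contains or eventually avoids each escaping orbit, so these base germs determine it up to a finite
set. Hence there are finitely many ends.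

For growth, a point whose escaping orbit avoids the exceptional set is determined by a base germ and
an element carrying its germ there (`GermRel.unique_left`). Counting points at distance `n` thus
becomes counting elements of `A`, once these elements have length linear in `n`. The only unbounded
ingredient is the time an orbit takes to reach the exceptional set; it is controlled by a Lipschitz
height that rises by one under `s` (`exists_height`, `exists_abs_height_le`), built from a character
to `ℚ` trivial on the stabilizer of a germ. -/

/-- The points from which the set `E` can be reached in at most `n` steps of the form
`x ↦ act s x` with `s ∈ S`. -/
def hubLayer {A X : Type*} (act : A → X → X) (S : Set A) (E : Set X) : ℕ → Set X
  | 0 => E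
  | n + 1 => hubLayer act S E n ∪ {x | ∃ s ∈ S, act s x ∈ hubLayer act S E n}

/-- A near action of finite type of a finitely generated abelian group, given by a family of
self-maps of `X`, together with a finite set (the hub) reached from all points of `X`. -/
structure NearSystem (A X : Type*) [CommGroup A] where
  act : A → X → X
  act_one : ∀ x, act 1 x = x
  act_mul : ∀ a b, ∀ᶠ x in cofinite, act a (act b x) = act (a * b) x
  gens : Set A
  gens_finite : gens.Finite
  inv_mem : ∀ s ∈ gens, s⁻¹ ∈ gens
  closure_gens : Subgroup.closure gens = ⊤
  hub : Set X
  hub_finite : hub.Finite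
  exists_mem_layer : ∀ x, ∃ n, x ∈ hubLayer act gens hub n

/-! ### Orbits of a single generator: escaping, periodic, or meeting a finite set -/

namespace NearSystem

variable {A X : Type*} [CommGroup A] (N : NearSystem A X)

/-- The points at distance at most `n` from the hub. -/
abbrev layer (n : ℕ) : Set X := hubLayer N.act N.gens N.hub n

theorem eventually_inv_act (a : A) : ∀ᶠ x in cofinite, N.act a⁻¹ (N.act a x) = x := by
  filter_upwards [N.act_mul a⁻¹ a] with x hx
  rw [hx, inv_mul_cancel, N.act_one]

theorem finite_preimage (a : A) {F : Set X} (hF : F.Finite) : {x | N.act a x ∈ F}.Finite := by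
  refine ((eventually_cofinite.1 (N.eventually_inv_act a)).union (hF.image (N.act a⁻¹))).subset ?_
  intro x hx
  by_cases h : N.act a⁻¹ (N.act a x) = x
  · exact Or.inr ⟨_, hx, h⟩
  · exact Or.inl h

theorem tendsto_act (a : A) : Tendsto (N.act a) cofinite cofinite := by
  intro U hU
  exact N.finite_preimage a hU

theorem eventually_iterate (a : A) (k : ℕ) :
    ∀ᶠ x in cofinite, (N.act a)^[k] x = N.act (a ^ k) x := by
  induction k with
  | zero => simp [N.act_one]
  | succ k ih =>
    filter_upwards [ih, N.act_mul a (a ^ k)] with x h1 h2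
    rw [Function.iterate_succ_apply', h1, h2, pow_succ']

/-- A finite set outside which the generators satisfy the commutation and inversion relations. -/
structure IsExceptional (B : Set X) : Prop where
  finite : B.Finite
  act_act : ∀ x ∉ B, ∀ s ∈ N.gens, ∀ t ∈ N.gens, N.act s (N.act t x) = N.act (s * t) x

theorem exists_isExceptional : ∃ B, N.IsExceptional B := by
  refine ⟨⋃ s ∈ N.gens, ⋃ t ∈ N.gens, {x | ¬ N.act s (N.act t x) = N.act (s * t) x}, ?_, ?_⟩
  · exact N.gens_finite.biUnion fun s _ => N.gens_finite.biUnion fun t _ => N.act_mul s t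
  · intro x hx s hs t ht
    by_contra h
    exact hx (Set.mem_biUnion hs (Set.mem_biUnion ht h))

/-- The forward orbit of `x` under `s` leaves every finite set. -/
def Escapes (s : A) (x : X) : Prop := Tendsto (fun k => (N.act s)^[k] x) atTop cofinite

/-- The points with an escaping forward orbit under `s` which avoids `B`. -/
def escapeSet (s : A) (B : Set X) : Set X :=
  {x | (∀ k, (N.act s)^[k] x ∉ B) ∧ N.Escapes s x}

/-- The points with a periodic orbit under `s` which avoids `B`. -/
def periodicSet (s : A) (B : Set X) : Set X :=
  {x | (∀ k, (N.act s)^[k] x ∉ B) ∧ ∃ p, 0 < p ∧ (N.act s)^[p] x = x}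

variable {N} {B : Set X}

namespace IsExceptional

theorem mono (hB : N.IsExceptional B) {F : Set X} (hF : F.Finite) : N.IsExceptional (B ∪ F) :=
  ⟨hB.finite.union hF, fun x hx => hB.act_act x fun h => hx (Or.inl h)⟩

theorem comm (hB : N.IsExceptional B) {x : X} (hx : x ∉ B) {s t : A} (hs : s ∈ N.gens)
    (ht : t ∈ N.gens) : N.act s (N.act t x) = N.act t (N.act s x) := by
  rw [hB.act_act x hx s hs t ht, hB.act_act x hx t ht s hs, mul_comm]

theorem inv_act (hB : N.IsExceptional B) {x : X} (hx : x ∉ B) {s : A} (hs : s ∈ N.gens) :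
    N.act s⁻¹ (N.act s x) = x := by
  rw [hB.act_act x hx _ (N.inv_mem s hs) _ hs, inv_mul_cancel, N.act_one]

theorem iterate_comm (hB : N.IsExceptional B) {x : X} {s t : A} (hs : s ∈ N.gens)
    (ht : t ∈ N.gens) {k : ℕ} (hx : ∀ j < k, (N.act s)^[j] x ∉ B) :
    N.act t ((N.act s)^[k] x) = (N.act s)^[k] (N.act t x) := by
  induction k with
  | zero => rfl
  | succ k ih =>
    rw [Function.iterate_succ_apply', Function.iterate_succ_apply',
      ← ih fun j hj => hx j (hj.trans k.lt_succ_self), hB.comm (hx k k.lt_succ_self) ht hs]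

theorem iterate_inv (hB : N.IsExceptional B) {x : X} {s : A} (hs : s ∈ N.gens) {k : ℕ}
    (hx : ∀ j < k, (N.act s)^[j] x ∉ B) {i : ℕ} (hi : i ≤ k) :
    (N.act s⁻¹)^[i] ((N.act s)^[k] x) = (N.act s)^[k - i] x := by
  induction i with
  | zero => rfl
  | succ i ih =>
    obtain ⟨j, rfl⟩ : ∃ j, k = j + (i + 1) := ⟨k - (i + 1), by omega⟩
    rw [Function.iterate_succ_apply', ih (by omega),
      show j + (i + 1) - i = j + 1 by omega, Function.iterate_succ_apply',
      hB.inv_act (hx j (by omega)) hs, Nat.add_sub_cancel]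

/-- A forward orbit avoiding the exceptional set either escapes or is periodic. -/
theorem trichotomy (hB : N.IsExceptional B) {s : A} (hs : s ∈ N.gens) (x : X) :
    (∃ k, (N.act s)^[k] x ∈ B) ∨ x ∈ N.escapeSet s B ∨ x ∈ N.periodicSet s B := by
  by_cases h : ∃ k, (N.act s)^[k] x ∈ B
  · exact Or.inl h
  push Not at h
  refine Or.inr ?_
  by_cases hinj : Function.Injective fun k => (N.act s)^[k] x
  · refine Or.inl ⟨h, ?_⟩
    have := hinj.tendsto_cofinite
    rwa [Nat.cofinite_eq_atTop] at this
  · refine Or.inr ⟨h, ?_⟩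
    have key : ∀ k l, k < l → (N.act s)^[k] x = (N.act s)^[l] x →
        ∃ p, 0 < p ∧ (N.act s)^[p] x = x := by
      intro k l hkl he
      refine ⟨l - k, by omega, ?_⟩
      rw [← hB.iterate_inv hs (fun j _ => h j) hkl.le, ← he,
        hB.iterate_inv hs (fun j _ => h j) le_rfl, Nat.sub_self, Function.iterate_zero_apply]
    simp only [Function.Injective, not_forall] at hinj
    obtain ⟨k, l, he, hne⟩ := hinj
    rcases lt_or_gt_of_ne hne with hlt | hlt
    · exact key k l hlt he
    · exact key l k hlt he.symm

/-- Only finitely many points have an orbit which meets the exceptional set in both directions. -/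
theorem finite_segments (hB : N.IsExceptional B) {s : A} (hs : s ∈ N.gens) :
    {x | (∃ k, (N.act s)^[k] x ∈ B) ∧ ∃ k, (N.act s⁻¹)^[k] x ∈ B}.Finite := by
  classical
  -- Each `x` is recovered by going backwards from its first hit `b`. As the backward orbit of `b`
  -- returns to `B` at some time `n ≥ 1`, the number of backward steps is less than `n`.
  have h1 : ∀ b ∈ B, {y | ∃ k, y = (N.act s⁻¹)^[k] b ∧
      (∀ j, 1 ≤ j → j ≤ k → (N.act s⁻¹)^[j] b ∉ B) ∧
      ∃ n, 1 ≤ n ∧ (N.act s⁻¹)^[n] b ∈ B}.Finite := by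
    intro b _
    by_cases h : ∃ n, 1 ≤ n ∧ (N.act s⁻¹)^[n] b ∈ B
    · obtain ⟨n, hn1, hn⟩ := h
      refine ((Set.finite_lt_nat n).image fun k => (N.act s⁻¹)^[k] b).subset ?_
      rintro y ⟨k, rfl, hk, -⟩
      refine ⟨k, ?_, rfl⟩
      by_contra hlt
      exact hk n hn1 (not_lt.1 hlt) hn
    · refine Set.finite_empty.subset ?_
      rintro y ⟨k, -, -, hn⟩
      exact h hn
  refine (hB.finite.union (hB.finite.biUnion h1)).subset ?_
  rintro x ⟨hf, ⟨l, hl⟩⟩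
  have hk := Nat.find_spec hf
  have hmin : ∀ j < Nat.find hf, (N.act s)^[j] x ∉ B := fun j hj => Nat.find_min hf hj
  generalize Nat.find hf = k at hk hmin
  rcases Nat.eq_zero_or_pos k with rfl | hpos
  · exact Or.inl hk
  refine Or.inr (Set.mem_biUnion hk ⟨k, ?_, ?_, k + l, by omega, ?_⟩)
  · rw [hB.iterate_inv hs hmin le_rfl, Nat.sub_self, Function.iterate_zero_apply]
  · intro j h1 hj
    rw [hB.iterate_inv hs hmin hj]
    exact hmin _ (by omega)
  · rw [add_comm, Function.iterate_add_apply, hB.iterate_inv hs hmin le_rfl, Nat.sub_self]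
    exact hl

end IsExceptional

/-- Only finitely many points are periodic under a given map and have an orbit which meets a given
finite set. -/
theorem finite_periodic_meeting {f : X → X} (hB : B.Finite) :
    {x | (∃ p, 0 < p ∧ f^[p] x = x) ∧ ∃ k, f^[k] x ∈ B}.Finite := by
  have h1 : ∀ b ∈ B, {y | ∃ p, 0 < p ∧ f^[p] b = b ∧ ∃ j, f^[j] b = y}.Finite := by
    intro b _
    by_cases h : ∃ p, 0 < p ∧ f^[p] b = b
    · obtain ⟨p, hp, hb⟩ := h
      refine ((Set.finite_lt_nat p).image fun k => f^[k] b).subset ?_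
      rintro y ⟨-, -, -, j, rfl⟩
      exact ⟨j % p, Nat.mod_lt _ hp, Function.IsPeriodicPt.iterate_mod_apply (f := f) hb j⟩
    · refine Set.finite_empty.subset ?_
      rintro y ⟨p, hp, hb, -⟩
      exact h ⟨p, hp, hb⟩
  refine (hB.biUnion h1).subset ?_
  rintro x ⟨⟨p, hp, hx⟩, k, hk⟩
  refine Set.mem_biUnion hk ⟨p, hp, ?_, p * k - k, ?_⟩
  · rw [← Function.iterate_add_apply, add_comm, Function.iterate_add_apply, hx]
  · have hle : k ≤ p * k := Nat.le_mul_of_pos_left k hp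
    rw [← Function.iterate_add_apply, Nat.sub_add_cancel hle]
    exact Function.IsPeriodicPt.mul_const (f := f) hx k

namespace IsExceptional

/-- On a cycle of `s⁻¹` avoiding `B`, the forward `s`-orbit is the same cycle read in the other
direction. -/
theorem mem_periodicSet_inv (hB : N.IsExceptional B) {s : A} (hs : s ∈ N.gens) {x : X}
    (hx : x ∈ N.periodicSet s⁻¹ B) : x ∈ N.periodicSet s B := by
  obtain ⟨ha, p, hp, hper⟩ := hx
  have hback : ∀ k i, i ≤ k → (N.act s)^[i] ((N.act s⁻¹)^[k] x) = (N.act s⁻¹)^[k - i] x := by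
    intro k i hi
    have := hB.iterate_inv (N.inv_mem s hs) (fun j _ => ha j) hi
    rwa [inv_inv] at this
  have hmul : ∀ k, (N.act s⁻¹)^[p * k] x = x := fun k =>
    Function.IsPeriodicPt.mul_const (f := N.act s⁻¹) hper k
  have hfwd : ∀ k, (N.act s)^[k] x = (N.act s⁻¹)^[p * k - k] x := fun k => by
    rw [← hback (p * k) k (Nat.le_mul_of_pos_left k hp), hmul]
  refine ⟨fun k => ?_, p, hp, ?_⟩
  · rw [hfwd]
    exact ha _
  · have := hback p p le_rfl
    rwa [hper, Nat.sub_self] at this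

/-- Commutation is needed only along the orbit of `x`; the orbit of `N.act t x` may meet `B`. -/
theorem act_isPeriodicPt (hB : N.IsExceptional B) {s t : A} (hs : s ∈ N.gens) (ht : t ∈ N.gens)
    {x : X} (hx : ∀ k, (N.act s)^[k] x ∉ B) {p : ℕ} (hp : (N.act s)^[p] x = x) :
    (N.act s)^[p] (N.act t x) = N.act t x := by
  rw [← hB.iterate_comm hs ht fun j _ => hx j, hp]

/-- All but finitely many points have an escaping orbit under some generator. -/
theorem finite_forall_notMem_escapeSet (hB : N.IsExceptional B) :
    {x | ∀ s ∈ N.gens, x ∉ N.escapeSet s B}.Finite := by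
  classical
  set Z : Set X := {x | ∀ s ∈ N.gens, x ∈ N.periodicSet s B} with hZ
  suffices hfin : Z.Finite by
    refine (hfin.union (N.gens_finite.biUnion fun s hs => hB.finite_segments hs)).subset ?_
    intro x hx
    by_cases hxZ : x ∈ Z
    · exact Or.inl hxZ
    · simp only [hZ, Set.mem_ofPred_eq, not_forall] at hxZ
      obtain ⟨s, hs, hns⟩ := hxZ
      have h1 : ∃ k, (N.act s)^[k] x ∈ B := by
        rcases hB.trichotomy hs x with h | h | h
        · exact h
        · exact absurd h (hx s hs)
        · exact absurd h hns
      refine Or.inr (Set.mem_biUnion hs ⟨h1, ?_⟩)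
      rcases hB.trichotomy (N.inv_mem s hs) x with h | h | h
      · exact h
      · exact absurd h (hx _ (N.inv_mem s hs))
      · exact absurd (hB.mem_periodicSet_inv hs h) hns
  -- the points of `Z` adjacent to a point outside `Z`
  have hexit : {x | x ∈ Z ∧ ∃ t ∈ N.gens, N.act t x ∉ Z}.Finite := by
    have h1 : (⋃ t ∈ N.gens, ⋃ s ∈ N.gens, {x | N.act t x ∈
        {y | (∃ p, 0 < p ∧ (N.act s)^[p] y = y) ∧ ∃ k, (N.act s)^[k] y ∈ B}}).Finite :=
      N.gens_finite.biUnion fun t _ => N.gens_finite.biUnion fun s _ =>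
        N.finite_preimage t (finite_periodic_meeting hB.finite)
    -- The image of a point of `Z` is still periodic under each generator, so it leaves `Z` only if
    -- one of its cycles meets `B`; only finitely many points have such a cycle.
    refine h1.subset ?_
    rintro x ⟨hx, t, ht, htx⟩
    simp only [hZ, Set.mem_ofPred_eq, not_forall] at htx
    obtain ⟨s, hs, hns⟩ := htx
    obtain ⟨ha, p, hp, hper⟩ := hx s hs
    have hper' := hB.act_isPeriodicPt hs ht ha hper
    refine Set.mem_biUnion ht (Set.mem_biUnion hs ⟨⟨p, hp, hper'⟩, ?_⟩)
    by_contra hcon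
    push Not at hcon
    exact hns ⟨hcon, p, hp, hper'⟩
  -- the periods are bounded
  have hperiod : ∀ s ∈ N.gens, ∃ p, 0 < p ∧ ∀ x ∈ Z, (N.act s)^[p] x = x := by
    intro s hs
    have hfinP := N.hub_finite.union hexit
    choose! q hq using fun (x : X) (hx : x ∈ Z) => (hx s hs).2
    have hq' : ∀ x ∈ Z, 0 < q x ∧ (N.act s)^[q x] x = x := hq
    -- A common multiple of the periods at the hub and at the exits of `Z` is enough: along a path
    -- to the hub, periods are transported from `N.act t x` back to `x` by `t⁻¹`.
    refine ⟨∏ x ∈ hfinP.toFinset, (if x ∈ Z then q x else 1), ?_, ?_⟩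
    · refine Finset.prod_pos fun x _ => ?_
      split_ifs with h
      · exact (hq' x h).1
      · exact one_pos
    · set p := ∏ x ∈ hfinP.toFinset, (if x ∈ Z then q x else 1)
      have hbase : ∀ x ∈ Z, (x ∈ N.hub ∨ ∃ t ∈ N.gens, N.act t x ∉ Z) →
          (N.act s)^[p] x = x := by
        intro x hx hor
        have hmem : x ∈ hfinP.toFinset := by
          rw [Set.Finite.mem_toFinset]
          exact hor.imp_right fun h => ⟨hx, h⟩
        obtain ⟨m, hm⟩ := Finset.dvd_prod_of_mem (fun x => if x ∈ Z then q x else 1) hmem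
        simp only [if_pos hx] at hm
        change p = _ at hm
        rw [hm]
        exact Function.IsPeriodicPt.mul_const (f := N.act s) (hq' x hx).2 m
      have hind : ∀ n, ∀ x ∈ N.layer n, x ∈ Z → (N.act s)^[p] x = x := by
        intro n
        induction n with
        | zero => exact fun x hx hxZ => hbase x hxZ (Or.inl hx)
        | succ n ih =>
          rintro x (hx | ⟨t, ht, htx⟩) hxZ
          · exact ih x hx hxZ
          · by_cases hZt : N.act t x ∈ Z
            · have h1 := hB.act_isPeriodicPt hs (N.inv_mem t ht) (hZt s hs).1 (ih _ htx hZt)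
              have h0 : x ∉ B := (hxZ s hs).1 0
              rwa [hB.inv_act h0 ht] at h1
            · exact hbase x hxZ (Or.inr ⟨t, ht, hZt⟩)
      intro x hx
      obtain ⟨n, hn⟩ := N.exists_mem_layer x
      exact hind n x hn hx
  choose! p hp hpZ using hperiod
  set U : Subgroup A := Subgroup.closure ((fun s => s ^ p s) '' N.gens) with hU
  have hUfix : ∀ u ∈ U, {x | x ∈ Z ∧ N.act u x ≠ x}.Finite := by
    intro u hu
    induction hu using Subgroup.closure_induction with
    | mem u hu =>
      obtain ⟨s, hs, rfl⟩ := hu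
      refine (eventually_cofinite.1 (N.eventually_iterate s (p s))).subset ?_
      rintro x ⟨hx, hne⟩ heq
      exact hne (heq.symm.trans (hpZ s hs x hx))
    | one =>
      refine Set.finite_empty.subset ?_
      rintro x ⟨-, hne⟩
      exact hne (N.act_one x)
    | mul u v _ _ hu hv =>
      refine ((hu.union hv).union (eventually_cofinite.1 (N.act_mul u v))).subset ?_
      rintro x ⟨hx, hne⟩
      by_contra hcon
      simp only [Set.mem_union, Set.mem_ofPred_eq, not_or, not_and, not_not] at hcon
      obtain ⟨⟨h1, h2⟩, h3⟩ := hcon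
      rw [← h3, h2 hx] at hne
      exact hne (h1 hx)
    | inv u _ hu =>
      refine (hu.union (eventually_cofinite.1 (N.eventually_inv_act u))).subset ?_
      rintro x ⟨hx, hne⟩
      by_contra hcon
      simp only [Set.mem_union, Set.mem_ofPred_eq, not_or, not_and, not_not] at hcon
      obtain ⟨h1, h2⟩ := hcon
      rw [h1 hx] at h2
      exact hne h2
  have hQ : Finite (A ⧸ U) := by
    have hfg : Group.FG A := ⟨⟨N.gens_finite.toFinset, by simpa using N.closure_gens⟩⟩
    refine CommGroup.finite_of_fg_isMulTorsion _ ?_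
    have htors : ∀ a : A, IsOfFinOrder (a : A ⧸ U) := by
      intro a
      have ha : a ∈ Subgroup.closure N.gens := by simp [N.closure_gens]
      induction ha using Subgroup.closure_induction with
      | mem s hs =>
        refine isOfFinOrder_iff_pow_eq_one.2 ⟨p s, hp s hs, ?_⟩
        rw [← QuotientGroup.mk_pow, QuotientGroup.eq_one_iff]
        exact Subgroup.subset_closure ⟨s, hs, rfl⟩
      | one => exact IsOfFinOrder.one
      | mul a b _ _ ha hb => exact (Commute.all _ _).isOfFinOrder_mul ha hb
      | inv a _ ha => exact ha.inv
    intro a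
    obtain ⟨a, rfl⟩ := QuotientGroup.mk_surjective a
    exact htors a
  -- the set of all representatives of `A ⧸ U` sends almost every point of `Z` to a closed set
  let r : A ⧸ U → A := Quotient.out
  have hr : ∀ q, (r q : A ⧸ U) = q := fun q => Quotient.out_eq q
  have hdiff : ∀ (t : A) (q : A ⧸ U), (r (t * q))⁻¹ * (t * r q) ∈ U := by
    intro t q
    rw [← QuotientGroup.eq, hr, QuotientGroup.mk_mul, hr]
  have hclosed : ∀ t : A, ∀ q : A ⧸ U,
      {x | x ∈ Z ∧ N.act t (N.act (r q) x) ≠ N.act (r (t * q)) x}.Finite := by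
    intro t q
    refine (((hUfix _ (hdiff t q)).union (eventually_cofinite.1 (N.act_mul t (r q)))).union
      (eventually_cofinite.1 (N.act_mul (r (t * q)) ((r (t * q))⁻¹ * (t * r q))))).subset ?_
    rintro x ⟨hx, hne⟩
    by_contra hcon
    simp only [Set.mem_union, Set.mem_ofPred_eq, not_or, not_and, not_not] at hcon
    obtain ⟨⟨h1, h2⟩, h3⟩ := hcon
    apply hne
    rw [h2, ← mul_inv_cancel_left (r (t * q)) (t * r q), ← h3, h1 hx]
  have hstart : {x | x ∈ Z ∧ N.act (r 1) x ≠ x}.Finite := by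
    refine hUfix _ ?_
    rw [← QuotientGroup.eq_one_iff, hr]
  have hmeet : (⋃ q : A ⧸ U, {x | N.act (r q) x ∈ N.hub}).Finite :=
    Set.finite_iUnion fun q => N.finite_preimage _ N.hub_finite
  refine ((hstart.union hmeet).union (N.gens_finite.biUnion fun t _ =>
    Set.finite_iUnion (hclosed t))).subset ?_
  intro x hx
  by_contra hcon
  simp only [Set.mem_union, Set.mem_ofPred_eq, Set.mem_iUnion, not_or, not_and, not_not,
    not_exists] at hcon
  obtain ⟨⟨h1, h2⟩, h3⟩ := hcon
  -- The finite set of all `N.act (r q) x` contains `x`, is stable under the generators and misses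
  -- the hub, so the hub cannot be reached from `x`.
  have hind : ∀ n, ∀ q : A ⧸ U, N.act (r q) x ∉ N.layer n := by
    intro n
    induction n with
    | zero => exact h2
    | succ n ih =>
      rintro q (hq | ⟨t, ht, hq⟩)
      · exact ih q hq
      · rw [h3 t ht q hx] at hq
        exact ih _ hq
  obtain ⟨n, hn⟩ := N.exists_mem_layer x
  rw [← h1 hx] at hn
  exact hind n 1 hn

end IsExceptional
end NearSystem

/-- An element of infinite order modulo a subgroup of an abelian group is sent to `1` by a
homomorphism to `ℚ` which vanishes on the subgroup. -/
theorem exists_rat_character {A : Type*} [CommGroup A] (H : Subgroup A) (s : A)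
    (hs : ∀ k : ℕ, 0 < k → s ^ k ∉ H) :
    ∃ φ : A → ℚ, (∀ a b, φ (a * b) = φ a + φ b) ∧ (∀ a ∈ H, φ a = 0) ∧ φ s = 1 := by
  let f : ℤ →+ Additive (A ⧸ H) := zmultiplesHom _ (Additive.ofMul (s : A ⧸ H))
  have hf : Function.Injective f := by
    rw [injective_iff_map_eq_zero]
    intro k hk
    have hk' : s ^ k ∈ H := by
      rw [← QuotientGroup.eq_one_iff, QuotientGroup.mk_zpow]
      exact hk
    by_contra hne
    refine hs k.natAbs (Int.natAbs_pos.2 hne) ?_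
    rcases Int.natAbs_eq k with h | h
    · rwa [h, zpow_natCast] at hk'
    · rwa [h, zpow_neg, zpow_natCast, inv_mem_iff] at hk'
  -- Divisibility of `ℚ` extends the inclusion of `ℤ` along the embedding of `ℤ` generated by the
  -- class of `s`.
  obtain ⟨φ, hφ⟩ := (Module.Baer.of_divisible ℚ).extension_property_addMonoidHom f hf
    (Int.castAddHom ℚ)
  refine ⟨fun a => φ (Additive.ofMul (a : A ⧸ H)), ?_, ?_, ?_⟩
  · intro a b
    beta_reduce
    rw [QuotientGroup.mk_mul, ofMul_mul, map_add]
  · intro a ha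
    beta_reduce
    rw [(QuotientGroup.eq_one_iff a).2 ha, ofMul_one, map_zero]
  · have := DFunLike.congr_fun hφ 1
    simpa [f] using this

/-! ### Germs of escaping orbits and near invariant sets -/

namespace NearSystem

variable {A X : Type*} [CommGroup A] (N : NearSystem A X)

/-- The element `g` sends the germ at infinity of the `s`-orbit of `x` to that of `y`. -/
def GermRel (s g : A) (x y : X) : Prop :=
  ∀ᶠ m in atTop, N.act g ((N.act s)^[m] x) = (N.act s)^[m] y

/-- The products of at most `n` generators. -/
abbrev ball (n : ℕ) : Set A := (insert 1 N.gens) ^ n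

variable {N} {B : Set X} {s g g' : A} {x y z : X}

theorem ball_mono {m n : ℕ} (h : m ≤ n) : N.ball m ⊆ N.ball n :=
  Set.pow_subset_pow_right (Set.mem_insert _ _) h

theorem mul_mem_ball {m n : ℕ} (hg : g ∈ N.ball m) (hg' : g' ∈ N.ball n) :
    g * g' ∈ N.ball (m + n) := by
  rw [ball, pow_add]
  exact Set.mul_mem_mul hg hg'

theorem mem_ball_one (hs : s ∈ N.gens) : s ∈ N.ball 1 := by
  rw [ball, pow_one]
  exact Set.mem_insert_of_mem _ hs

theorem pow_mem_ball (hs : s ∈ N.gens) (k : ℕ) : s ^ k ∈ N.ball k :=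
  Set.pow_mem_pow (Set.mem_insert_of_mem _ hs)

namespace GermRel

theorem refl (s : A) (x : X) : N.GermRel s 1 x x := Eventually.of_forall fun _ => N.act_one _

theorem trans (hx : N.Escapes s x) (h₁ : N.GermRel s g x y) (h₂ : N.GermRel s g' y z) :
    N.GermRel s (g' * g) x z := by
  filter_upwards [h₁, h₂, hx.eventually (N.act_mul g' g)] with m h1 h2 h3
  rw [← h3, h1, h2]

theorem symm (hx : N.Escapes s x) (h : N.GermRel s g x y) : N.GermRel s g⁻¹ y x := by
  filter_upwards [h, hx.eventually (N.eventually_inv_act g)] with m h1 h2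
  rw [← h1, h2]

theorem escapes (hx : N.Escapes s x) (h : N.GermRel s g x y) : N.Escapes s y :=
  ((N.tendsto_act g).comp hx).congr' h

theorem iterate (hx : N.Escapes s x) (k : ℕ) : N.GermRel s (s ^ k) x ((N.act s)^[k] x) := by
  filter_upwards [hx.eventually (N.eventually_iterate s k)] with m h
  rw [← h, ← Function.iterate_add_apply, ← Function.iterate_add_apply, add_comm]

theorem act (hB : N.IsExceptional B) (hs : s ∈ N.gens) {t : A} (ht : t ∈ N.gens)
    (hx : x ∈ N.escapeSet s B) : N.GermRel s t x (N.act t x) :=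
  Eventually.of_forall fun _ => hB.iterate_comm hs ht fun j _ => hx.1 j

/-- At a late time `g` is cancelled by its inverse, so the two orbits coincide there; since both
avoid `B`, running `s⁻¹` brings the equality back to time zero. -/
theorem unique_left (hB : N.IsExceptional B) (hs : s ∈ N.gens) (hx : x ∈ N.escapeSet s B)
    (hy : y ∈ N.escapeSet s B) (h₁ : N.GermRel s g x z) (h₂ : N.GermRel s g y z) : x = y := by
  obtain ⟨m, h1, h2, h3, h4⟩ := (h₁.and (h₂.and ((hx.2.eventually (N.eventually_inv_act g)).and
    (hy.2.eventually (N.eventually_inv_act g))))).exists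
  have heq : (N.act s)^[m] x = (N.act s)^[m] y := by rw [← h3, ← h4, h1, h2]
  have h5 := hB.iterate_inv hs (fun j _ => hx.1 j) (le_refl m)
  have h6 := hB.iterate_inv hs (fun j _ => hy.1 j) (le_refl m)
  rw [Nat.sub_self] at h5 h6
  rw [heq, h6] at h5
  exact h5.symm

end GermRel

theorem Escapes.not_isPeriodicPt (hx : N.Escapes s x) {p : ℕ} (hp : 0 < p) (k : ℕ) :
    (N.act s)^[p] ((N.act s)^[k] x) ≠ (N.act s)^[k] x := by
  intro h
  have h1 := hx.eventually (Set.finite_singleton ((N.act s)^[k] x)).eventually_cofinite_notMem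
  obtain ⟨n, hn⟩ := eventually_atTop.1 h1
  refine hn (p * n + k) (by nlinarith) ?_
  rw [Function.iterate_add_apply]
  exact Function.IsPeriodicPt.mul_const (f := N.act s) h n

theorem Escapes.iterate (hx : N.Escapes s x) (k : ℕ) : N.Escapes s ((N.act s)^[k] x) :=
  (GermRel.iterate hx k).escapes hx

theorem Escapes.exists_iterate_mem_escapeSet (hB : B.Finite) (hx : N.Escapes s x) :
    ∃ k, (N.act s)^[k] x ∈ N.escapeSet s B := by
  obtain ⟨n, hn⟩ := eventually_atTop.1 (hx.eventually hB.eventually_cofinite_notMem)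
  refine ⟨n, fun k => ?_, hx.iterate n⟩
  rw [← Function.iterate_add_apply]
  exact hn _ (Nat.le_add_left n k)

/-- Follow a path to the hub while the `s`-orbits avoid `B`: each step `t` then commutes with `s`
along the whole orbit and contributes one factor to `g`. Stop at the hub or at the first vertex
whose `s`-orbit meets `B`. -/
theorem IsExceptional.exists_germRel_of_mem_layer (hB : N.IsExceptional B) (hs : s ∈ N.gens)
    (n : ℕ) : ∀ x ∈ N.escapeSet s B, x ∈ N.layer n → ∃ z ∈ N.layer n, N.Escapes s z ∧
      (z ∈ N.hub ∨ ∃ k, (N.act s)^[k] z ∈ B) ∧ ∃ g ∈ N.ball n, N.GermRel s g x z := by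
  induction n with
  | zero =>
    intro x hx hn
    exact ⟨x, hn, hx.2, Or.inl hn, 1, by simp [ball], GermRel.refl s x⟩
  | succ n ih =>
    rintro x hx (hn | ⟨t, ht, hn⟩)
    · obtain ⟨z, hz, h1, h2, g, hg, h3⟩ := ih x hx hn
      exact ⟨z, Or.inl hz, h1, h2, g, ball_mono n.le_succ hg, h3⟩
    · have hgerm := GermRel.act hB hs ht hx
      have hesc := hgerm.escapes hx.2
      by_cases h : ∃ k, (N.act s)^[k] (N.act t x) ∈ B
      · exact ⟨_, Or.inl hn, hesc, Or.inr h, t, ball_mono (by omega) (mem_ball_one ht), hgerm⟩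
      · obtain ⟨z, hz, h1, h2, g, hg, h3⟩ := ih _ ⟨not_exists.1 h, hesc⟩ hn
        exact ⟨z, Or.inl hz, h1, h2, g * t, mul_mem_ball hg (mem_ball_one ht),
          hgerm.trans hx.2 h3⟩

/-- Up to the action of the group, there are only finitely many germs of escaping orbits. -/
theorem IsExceptional.exists_germRel_base (hB : N.IsExceptional B) (hs : s ∈ N.gens)
    (hx : N.Escapes s x) :
    ∃ p ∈ N.hub ∪ B, N.Escapes s p ∧ ∃ g, N.GermRel s g x p := by
  obtain ⟨k, hk⟩ := hx.exists_iterate_mem_escapeSet hB.finite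
  have h0 := GermRel.iterate hx k
  obtain ⟨n, hn⟩ := N.exists_mem_layer ((N.act s)^[k] x)
  obtain ⟨z, -, hz, h1, g, -, hg⟩ := hB.exists_germRel_of_mem_layer hs n _ hk hn
  have h2 := h0.trans hx hg
  rcases h1 with h1 | ⟨i, hi⟩
  · exact ⟨z, Or.inl h1, hz, _, h2⟩
  · exact ⟨_, Or.inr hi, hz.iterate i, _, h2.trans hx (GermRel.iterate hz i)⟩

variable (N) in
/-- Only finitely many points of `Y` or of its complement are moved across by a given element. -/
def IsNearInvariant (Y : Set X) : Prop := ∀ a, ∀ᶠ x in cofinite, N.act a x ∈ Y ↔ x ∈ Y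

theorem IsNearInvariant.symmDiff {Y Z : Set X} (hY : N.IsNearInvariant Y)
    (hZ : N.IsNearInvariant Z) : N.IsNearInvariant (Y ∆ Z) := by
  intro a
  filter_upwards [hY a, hZ a] with x h1 h2
  rw [Set.mem_symmDiff, Set.mem_symmDiff, h1, h2]

/-- A point entering `Y` under `a` gives, up to finitely many exceptions, a point leaving `Y` under
`a⁻¹`. -/
theorem IsNearInvariant.of_forall_finite {Y : Set X}
    (h : ∀ a, {x | x ∈ Y ∧ N.act a x ∉ Y}.Finite) : N.IsNearInvariant Y := by
  intro a
  filter_upwards [(h a).eventually_cofinite_notMem, N.eventually_inv_act a,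
    (N.tendsto_act a).eventually (h a⁻¹).eventually_cofinite_notMem] with x h1 h2 h3
  simp only [h2] at h1 h3
  tauto

/-- A near invariant subset is determined, up to a finite set, by the germs of orbits of finitely
many points which lie in it. -/
theorem exists_finite_determining_set : ∃ P : Set X, P.Finite ∧ ∀ Y Z : Set X,
    N.IsNearInvariant Y → N.IsNearInvariant Z →
    (∀ s ∈ N.gens, ∀ p ∈ P, (∀ᶠ k in atTop, (N.act s)^[k] p ∈ Y) ↔
      ∀ᶠ k in atTop, (N.act s)^[k] p ∈ Z) → (Y ∆ Z).Finite := by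
  obtain ⟨B, hB⟩ := N.exists_isExceptional
  refine ⟨N.hub ∪ B, N.hub_finite.union hB.finite, ?_⟩
  intro Y Z hY hZ heq
  have hW := hY.symmDiff hZ
  -- Adding these points to the exceptional set keeps inside `Y ∆ Z` every orbit that starts there
  -- and avoids it.
  have hF : (⋃ s ∈ N.gens, {x | ¬ (N.act s x ∈ Y ∆ Z ↔ x ∈ Y ∆ Z)}).Finite :=
    N.gens_finite.biUnion fun s _ => hW s
  refine (hB.mono hF).finite_forall_notMem_escapeSet.subset ?_
  rintro x hx s hs ⟨havoid, hesc⟩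
  have hstay : ∀ k, (N.act s)^[k] x ∈ Y ∆ Z := by
    intro k
    induction k with
    | zero => exact hx
    | succ k ih =>
      rw [Function.iterate_succ_apply']
      by_contra hcon
      refine havoid k (Or.inr (Set.mem_biUnion hs ?_))
      exact fun h => hcon (h.2 ih)
  obtain ⟨p, hp, hpe, g, hg⟩ := hB.exists_germRel_base hs hesc
  have hpW : ∀ᶠ k in atTop, (N.act s)^[k] p ∈ Y ∆ Z := by
    filter_upwards [hg, hesc.eventually (hW g)] with k h1 h2
    rw [← h1]
    exact h2.2 (hstay k)
  -- An escaping orbit crosses the boundary of `Y` only finitely often, so membership in `Y` is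
  -- eventually constant.
  have hpY : (∀ᶠ k in atTop, (N.act s)^[k] p ∈ Y) ∨ ∀ᶠ k in atTop, (N.act s)^[k] p ∉ Y := by
    obtain ⟨n, hn⟩ := eventually_atTop.1 (hpe.eventually (hY s))
    have hconst : ∀ k, n ≤ k → ((N.act s)^[k] p ∈ Y ↔ (N.act s)^[n] p ∈ Y) := by
      intro k hk
      induction k, hk using Nat.le_induction with
      | base => rfl
      | succ k hk ih => rw [Function.iterate_succ_apply', hn k hk, ih]
    by_cases h : (N.act s)^[n] p ∈ Y
    · exact Or.inl (eventually_atTop.2 ⟨n, fun k hk => (hconst k hk).2 h⟩)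
    · exact Or.inr (eventually_atTop.2 ⟨n, fun k hk hc => h ((hconst k hk).1 hc)⟩)
  rcases hpY with h | h
  · obtain ⟨k, h1, h2, h3⟩ := (h.and (((heq s hs p hp).1 h).and hpW)).exists
    rw [Set.mem_symmDiff] at h3
    tauto
  · have h' : ∀ᶠ k in atTop, (N.act s)^[k] p ∈ Z := by
      filter_upwards [h, hpW] with k h1 h2
      rw [Set.mem_symmDiff] at h2
      tauto
    obtain ⟨k, h1, h2⟩ := (h.and ((heq s hs p hp).2 h')).exists
    exact h1 h2

end NearSystem

/-! ### Height functions and the growth of layers -/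

theorem Set.Finite.exists_forall_le {ι : Type*} {S : Set ι} (hS : S.Finite) (f : ι → ℚ) :
    ∃ c, 0 ≤ c ∧ ∀ i ∈ S, f i ≤ c := by
  obtain ⟨c, hc⟩ := (hS.image f).bddAbove
  exact ⟨max 0 c, le_max_left _ _, fun i hi => (hc ⟨i, hi, rfl⟩).trans (le_max_right _ _)⟩

theorem exists_forall_le_of_eventually_cofinite {ι : Type*} {f : ι → ℚ} {c : ℚ}
    (h : ∀ᶠ i in cofinite, f i ≤ c) : ∃ c', 0 ≤ c' ∧ ∀ i, f i ≤ c' := by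
  obtain ⟨d, hd, hd'⟩ := (eventually_cofinite.1 h).exists_forall_le f
  refine ⟨max c d, le_max_of_le_right hd, fun i => ?_⟩
  by_cases hi : f i ≤ c
  · exact hi.trans (le_max_left _ _)
  · exact (hd' i hi).trans (le_max_right _ _)

theorem Finset.encard_biUnion_le_mul {ι X : Type*} (F : Finset ι) (T : ι → Set X) (c : ℕ∞)
    (h : ∀ i ∈ F, (T i).encard ≤ c) : (⋃ i ∈ F, T i).encard ≤ F.card * c :=
  (F.set_encard_biUnion_le T).trans (by simpa using Finset.sum_le_card_nsmul F _ c h)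

namespace NearSystem

variable {A X : Type*} [CommGroup A] {N : NearSystem A X} {B : Set X} {s g g' : A} {x y z : X}

/-- The elements which fix the germ of an escaping orbit. -/
def germStabilizer (hx : N.Escapes s x) : Subgroup A where
  carrier := {g | N.GermRel s g x x}
  one_mem' := GermRel.refl s x
  mul_mem' := fun ha hb => GermRel.trans hx hb ha
  inv_mem' := fun ha => GermRel.symm hx ha

theorem mem_germStabilizer (hx : N.Escapes s x) :
    g ∈ germStabilizer hx ↔ N.GermRel s g x x := Iff.rfl

/-- Otherwise a late point of the orbit would be periodic. This gives `s` infinite order modulo the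
stabilizer, as `exists_rat_character` requires. -/
theorem pow_notMem_germStabilizer (hx : N.Escapes s x) {k : ℕ} (hk : 0 < k) :
    s ^ k ∉ germStabilizer hx := by
  intro h
  obtain ⟨m, h1, h2⟩ := (((mem_germStabilizer hx).1 h).and
    (hx.eventually (N.eventually_iterate s k))).exists
  exact hx.not_isPeriodicPt hk m (h2.trans h1)

theorem abs_le_mul_of_mem_ball {φ : A → ℚ} (hφ : ∀ a b, φ (a * b) = φ a + φ b) {C : ℚ}
    (hC : ∀ t ∈ N.gens, |φ t| ≤ C) (hC0 : 0 ≤ C) (n : ℕ) : ∀ g ∈ N.ball n, |φ g| ≤ C * n := by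
  have h1 : φ 1 = 0 := by simpa using hφ 1 1
  induction n with
  | zero =>
    intro g hg
    simp only [ball, pow_zero, Set.mem_one] at hg
    simp [hg, h1]
  | succ n ih =>
    intro g hg
    rw [ball, pow_succ] at hg
    obtain ⟨a, ha, t, ht, rfl⟩ := Set.mem_mul.1 hg
    have h2 : |φ t| ≤ C := by
      rcases ht with rfl | ht
      · simpa [h1] using hC0
      · exact hC t ht
    rw [hφ, Nat.cast_add, Nat.cast_one, mul_add, mul_one]
    exact (abs_add_le _ _).trans (add_le_add (ih a ha) h2)

/-- There is a height function on the points with an escaping `s`-orbit, which increases by `1`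
under `s`, and changes by a bounded amount under each generator. -/
theorem IsExceptional.exists_height (hB : N.IsExceptional B) (hs : s ∈ N.gens) :
    ∃ (h : X → ℚ) (C : ℚ), 0 ≤ C ∧ (∀ x, N.Escapes s x → ∀ k : ℕ, h ((N.act s)^[k] x) = h x + k) ∧
      ∀ n, ∀ g ∈ N.ball n, ∀ x y, N.Escapes s x → N.GermRel s g x y → |h y - h x| ≤ C * n := by
  classical
  rcases isEmpty_or_nonempty X with hX | hX
  · exact ⟨0, 0, le_rfl, fun x => hX.elim x, fun _ _ _ x => hX.elim x⟩
  have hchar : ∀ p, ∃ φ : A → ℚ, N.Escapes s p → (∀ a b, φ (a * b) = φ a + φ b) ∧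
      (∀ g, N.GermRel s g p p → φ g = 0) ∧ φ s = 1 := by
    intro p
    by_cases hp : N.Escapes s p
    · obtain ⟨φ, h⟩ := exists_rat_character (germStabilizer hp) s
        fun k hk => pow_notMem_germStabilizer hp hk
      exact ⟨φ, fun _ => h⟩
    · exact ⟨0, fun h => absurd h hp⟩
  choose φ hφ using hchar
  let base : X → Set X := fun x => {p | p ∈ N.hub ∪ B ∧ ∃ g, N.GermRel s g x p}
  -- The choice depends only on the set `base x`, so it is constant on germs related by the group.
  -- The height is `-φ (γ x)`, where `γ x` carries the germ of `x` to that of `rep x`; two such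
  -- elements differ by a stabilizer element, on which `φ` vanishes.
  let rep : X → X := fun x => Classical.epsilon fun p => p ∈ base x
  have hrep : ∀ x, N.Escapes s x → rep x ∈ base x := by
    intro x hx
    obtain ⟨p, hp, -, hg⟩ := hB.exists_germRel_base hs hx
    exact Classical.epsilon_spec (p := fun p => p ∈ base x) ⟨p, hp, hg⟩
  have hrep_eq : ∀ x y g, N.Escapes s x → N.GermRel s g x y → rep y = rep x := by
    intro x y g hx hg
    have : base y = base x := by
      ext p
      constructor
      · rintro ⟨hp, a, ha⟩
        exact ⟨hp, _, hg.trans hx ha⟩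
      · rintro ⟨hp, a, ha⟩
        exact ⟨hp, _, (hg.symm hx).trans (hg.escapes hx) ha⟩
    simp only [rep, this]
  choose! γ hγ using fun x (hx : N.Escapes s x) => (hrep x hx).2
  have key : ∀ x y g, N.Escapes s x → N.GermRel s g x y →
      -φ (rep y) (γ y) - -φ (rep x) (γ x) = φ (rep x) g := by
    intro x y g hx hg
    have hy := hg.escapes hx
    have h1 := hγ x hx
    have h2 := hγ y hy
    have hr := h1.escapes hx
    obtain ⟨hadd, hstab, -⟩ := hφ _ hr
    rw [hrep_eq x y g hx hg] at h2 ⊢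
    have h3 := hstab _ ((h1.symm hx).trans hr (hg.trans hx h2))
    have h4 := hadd (γ x) (γ x)⁻¹
    have h5 := hstab _ (GermRel.refl s (rep x))
    rw [mul_inv_cancel, h5] at h4
    rw [hadd, hadd] at h3
    linarith
  obtain ⟨C, hC0, hC⟩ := ((N.hub_finite.union hB.finite).prod N.gens_finite).exists_forall_le
    fun q => |φ q.1 q.2|
  refine ⟨fun x => -φ (rep x) (γ x), C, hC0, ?_, ?_⟩
  · intro x hx k
    have h1 := key _ _ _ hx (GermRel.iterate hx k)
    obtain ⟨hadd, hstab, hone⟩ := hφ _ ((hγ x hx).escapes hx)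
    have h2 : ∀ k : ℕ, φ (rep x) (s ^ k) = k := by
      intro k
      induction k with
      | zero => simpa using hstab _ (GermRel.refl s (rep x))
      | succ k ih => rw [pow_succ, hadd, ih, hone, Nat.cast_add, Nat.cast_one]
    rw [h2] at h1
    linarith
  · intro n g hg x y hx hxy
    change |-φ (rep y) (γ y) - -φ (rep x) (γ x)| ≤ _
    rw [key x y g hx hxy]
    obtain ⟨hadd, -, -⟩ := hφ _ ((hγ x hx).escapes hx)
    exact abs_le_mul_of_mem_ball hadd (fun t ht => hC (rep x, t) ⟨(hrep x hx).1, ht⟩) hC0 n g hg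

variable (N) in
/-- The time at which the forward orbit of `x` first meets `B`. -/
noncomputable def hittingTime (s : A) (B : Set X) (x : X) : ℕ := sInf {k | (N.act s)^[k] x ∈ B}

theorem iterate_hittingTime_mem (hx : ∃ k, (N.act s)^[k] x ∈ B) :
    (N.act s)^[N.hittingTime s B x] x ∈ B :=
  Nat.sInf_mem (s := {k | (N.act s)^[k] x ∈ B}) hx

theorem iterate_notMem_of_lt_hittingTime {j : ℕ} (hj : j < N.hittingTime s B x) :
    (N.act s)^[j] x ∉ B :=
  Nat.notMem_of_lt_sInf (s := {k | (N.act s)^[k] x ∈ B}) hj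

theorem hittingTime_le {k : ℕ} (hk : (N.act s)^[k] x ∈ B) : N.hittingTime s B x ≤ k :=
  Nat.sInf_le (s := {k | (N.act s)^[k] x ∈ B}) hk

theorem hittingTime_le_iterate_add (hx : ∃ k, (N.act s)^[k] x ∈ B) {j : ℕ}
    (hj : j ≤ N.hittingTime s B x) :
    N.hittingTime s B x ≤ N.hittingTime s B ((N.act s)^[j] x) + j := by
  apply hittingTime_le
  rw [Function.iterate_add_apply]
  refine iterate_hittingTime_mem ⟨N.hittingTime s B x - j, ?_⟩
  rw [← Function.iterate_add_apply, Nat.sub_add_cancel hj]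
  exact iterate_hittingTime_mem hx

/-- The height of an escaping point is bounded linearly by its distance to the hub. -/
theorem IsExceptional.exists_abs_height_le (hB : N.IsExceptional B) (hs : s ∈ N.gens)
    {h₀ : X → ℚ} {C : ℚ}
    (hstep : ∀ x, N.Escapes s x → ∀ k : ℕ, h₀ ((N.act s)^[k] x) = h₀ x + k)
    (hlip : ∀ n, ∀ g ∈ N.ball n, ∀ x y, N.Escapes s x → N.GermRel s g x y →
      |h₀ y - h₀ x| ≤ C * n) :
    ∃ D : ℚ, 0 ≤ D ∧ ∀ n : ℕ, ∀ x ∈ N.escapeSet s B, x ∈ N.layer n → |h₀ x| ≤ D * (n + 1) := by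
  classical
  let τ := N.hittingTime s B
  -- Paths to the hub may leave the escaping region, so the height is extended to all of `X`. Minus
  -- the hitting time also rises by one under `s` until `B` is met, and every generator changes the
  -- extended `h` boundedly.
  let h : X → ℚ := fun x => if x ∈ N.escapeSet s B then h₀ x else
    if ∃ k, (N.act s)^[k] x ∈ B then -(τ x : ℚ) else 0
  have h_esc : ∀ x ∈ N.escapeSet s B, h x = h₀ x := fun x hx => if_pos hx
  have h_hit : ∀ x, (∃ k, (N.act s)^[k] x ∈ B) → h x = -(τ x : ℚ) := by
    intro x hx
    have : x ∉ N.escapeSet s B := fun hc => hx.elim fun k hk => hc.1 k hk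
    simp only [h, if_neg this, if_pos hx]
  have h_per : ∀ x ∈ N.periodicSet s B, h x = 0 := by
    rintro x ⟨hx, p, hp, hper⟩
    have h1 : x ∉ N.escapeSet s B := fun hc => hc.2.not_isPeriodicPt hp 0 hper
    have h2 : ¬ ∃ k, (N.act s)^[k] x ∈ B := not_exists.2 hx
    simp only [h, if_neg h1, if_neg h2]
  have hF : (⋃ t ∈ N.gens, N.act t '' B).Finite :=
    N.gens_finite.biUnion fun t _ => hB.finite.image _
  obtain ⟨M, hM0, hM⟩ := hF.exists_forall_le fun q => max |h₀ q| (τ q)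
  have h_esc_hit : ∀ x ∈ N.escapeSet s B, ∀ t ∈ N.gens, (∃ k, (N.act s)^[k] (N.act t x) ∈ B) →
      |h (N.act t x) - h x| ≤ M := by
    intro x hx t ht hit
    rw [h_esc x hx, h_hit _ hit]
    have h1 := hB.iterate_comm hs ht fun j (_ : j < τ (N.act t x)) => hx.1 j
    have h2 := hB.inv_act (hx.1 (τ (N.act t x))) ht
    -- When the orbit of `N.act t x` first meets `B`, that of `x` is in a finite set of translates
    -- of `B`, where heights are at most `M`.
    have h3 : (N.act s)^[τ (N.act t x)] x ∈ ⋃ t ∈ N.gens, N.act t '' B := by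
      refine Set.mem_biUnion (N.inv_mem t ht) ⟨_, ?_, h2⟩
      rw [h1]
      exact iterate_hittingTime_mem hit
    have h4 := (le_max_left _ _).trans (hM _ h3)
    rw [hstep x hx.2] at h4
    rw [abs_sub_comm, sub_neg_eq_add]
    exact h4
  have h_hit_hit : ∀ x, (∃ k, (N.act s)^[k] x ∈ B) → ∀ t ∈ N.gens,
      (∃ k, (N.act s)^[k] (N.act t x) ∈ B) → (τ (N.act t x) : ℚ) ≤ τ x + M := by
    intro x hx t ht htx
    rcases le_total (τ x) (τ (N.act t x)) with hle | hle
    · have h1 := hittingTime_le_iterate_add htx hle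
      rw [← hB.iterate_comm hs ht fun j hj => iterate_notMem_of_lt_hittingTime hj] at h1
      have h2 := (le_max_right _ _).trans
        (hM _ (Set.mem_biUnion ht ⟨_, iterate_hittingTime_mem hx, rfl⟩))
      have h3 : (τ (N.act t x) : ℚ) ≤ τ (N.act t ((N.act s)^[τ x] x)) + τ x := mod_cast h1
      linarith
    · have h3 : (τ (N.act t x) : ℚ) ≤ τ x := mod_cast hle
      linarith
  have hmeet := finite_periodic_meeting (f := N.act s) hB.finite
  have hev : ∀ t ∈ N.gens, ∃ c, 0 ≤ c ∧ ∀ x, |h (N.act t x) - h x| ≤ c := by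
    intro t ht
    refine exists_forall_le_of_eventually_cofinite (c := max C M) ?_
    filter_upwards [hB.finite.eventually_cofinite_notMem, hmeet.eventually_cofinite_notMem,
      (N.tendsto_act t).eventually hmeet.eventually_cofinite_notMem] with x hxB hx1 hx2
    have hinv := hB.inv_act hxB ht
    have ht' := N.inv_mem t ht
    -- Neighbours of different types are either escaping and hitting, with bounded jump, or escaping
    -- and periodic, which is impossible, or periodic and hitting, which the filtered-out finite
    -- sets exclude.
    rcases hB.trichotomy hs x with hx | hx | hx <;>
      rcases hB.trichotomy hs (N.act t x) with hy | hy | hy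
    · refine le_max_of_le_right ?_
      have h1 := h_hit_hit x hx t ht hy
      have h2 := h_hit_hit (N.act t x) hy t⁻¹ ht' (by rwa [hinv])
      rw [hinv] at h2
      rw [h_hit _ hx, h_hit _ hy, abs_le]
      constructor <;> linarith
    · refine le_max_of_le_right ?_
      have h1 := h_esc_hit _ hy t⁻¹ ht' (by rwa [hinv])
      rwa [hinv, abs_sub_comm] at h1
    · obtain ⟨ha, p, hp, hper⟩ := hy
      have h1 := hB.act_isPeriodicPt hs ht' ha hper
      rw [hinv] at h1
      exact absurd ⟨⟨p, hp, h1⟩, hx⟩ hx1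
    · exact le_max_of_le_right (h_esc_hit x hx t ht hy)
    · refine le_max_of_le_left ?_
      rw [h_esc _ hx, h_esc _ hy]
      simpa using hlip 1 t (mem_ball_one ht) x _ hx.2 (GermRel.act hB hs ht hx)
    · obtain ⟨ha, p, hp, hper⟩ := hy
      exact absurd hper (((GermRel.act hB hs ht hx).escapes hx.2).not_isPeriodicPt hp 0)
    · obtain ⟨ha, p, hp, hper⟩ := hx
      exact absurd ⟨⟨p, hp, hB.act_isPeriodicPt hs ht ha hper⟩, hy⟩ hx2
    · obtain ⟨ha, p, hp, hper⟩ := hx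
      have h1 := (GermRel.act hB hs ht' hy).escapes hy.2
      rw [hinv] at h1
      exact absurd hper (h1.not_isPeriodicPt hp 0)
    · rw [h_per _ hx, h_per _ hy]
      simpa using Or.inr hM0
  choose! c hc0 hc using hev
  obtain ⟨D, hD0, hD⟩ := N.gens_finite.exists_forall_le c
  obtain ⟨E, hE0, hE⟩ := N.hub_finite.exists_forall_le fun x => |h x|
  have hlayer : ∀ n : ℕ, ∀ x ∈ N.layer n, |h x| ≤ E + D * n := by
    intro n
    induction n with
    | zero =>
      intro x hx
      simpa using hE x hx
    | succ n ih =>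
      rw [Nat.cast_add, Nat.cast_one]
      rintro x (hx | ⟨t, ht, hx⟩)
      · linarith [ih x hx]
      · have h1 := ih _ hx
        have h2 := (hc t ht x).trans (hD t ht)
        have h3 := abs_sub_abs_le_abs_sub (h x) (h (N.act t x))
        rw [abs_sub_comm] at h3
        linarith
  refine ⟨E + D, add_nonneg hE0 hD0, fun n x hx hn => ?_⟩
  rw [← h_esc x hx]
  have h1 := hlayer n x hn
  have h2 : 0 ≤ E * n := mul_nonneg hE0 n.cast_nonneg
  linarith

/-- The number of points of a layer with an escaping `s`-orbit is bounded in terms of the growth of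
the group. -/
theorem IsExceptional.exists_encard_escapeSet_le (hB : N.IsExceptional B) (hs : s ∈ N.gens) :
    ∃ C : ℕ, ∀ n, (N.layer n ∩ N.escapeSet s B).encard ≤ C * (N.ball (C * (n + 1))).encard := by
  obtain ⟨h, C, hC0, hstep, hlip⟩ := hB.exists_height hs
  obtain ⟨D, hD0, hD⟩ := hB.exists_abs_height_le hs hstep hlip
  obtain ⟨M, hM0, hM⟩ := hB.finite.exists_forall_le fun x => |h x|
  have hP := N.hub_finite.union hB.finite
  -- If `z` reaches `B` after `k` steps, then `k` is the height gained: at most `M` at the end, `C *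
  -- n` between `x` and `z`, and `D * (n + 1)` at `x`.
  obtain ⟨L, hL⟩ := exists_nat_ge (M + C + D)
  have hcover : ∀ n, N.layer n ∩ N.escapeSet s B ⊆ ⋃ p ∈ hP.toFinset,
      {x | x ∈ N.escapeSet s B ∧ ∃ g ∈ N.ball ((L + 1) * (n + 1)), N.GermRel s g x p} := by
    rintro n x ⟨hn, hx⟩
    obtain ⟨z, -, hz, hor, g, hg, hgerm⟩ := hB.exists_germRel_of_mem_layer hs n x hx hn
    rcases hor with hz' | ⟨k, hk⟩
    · refine Set.mem_biUnion (x := z) ?_ ⟨hx, g, ball_mono ?_ hg, hgerm⟩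
      · simpa using Or.inl hz'
      · nlinarith
    · refine Set.mem_biUnion (x := (N.act s)^[k] z) ?_
        ⟨hx, s ^ k * g, ?_, hgerm.trans hx.2 (GermRel.iterate hz k)⟩
      · simpa using Or.inr hk
      refine ball_mono ?_ (mul_mem_ball (pow_mem_ball hs k) hg)
      have h1 := abs_le.1 (hlip n g hg x z hx.2 hgerm)
      have h2 := abs_le.1 (hD n x hx hn)
      have h3 := abs_le.1 (hM _ hk)
      rw [hstep z hz] at h3
      have h4 : (0 : ℚ) ≤ n := n.cast_nonneg
      have h5 : (k : ℚ) ≤ L * (n + 1) := by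
        have h6 : (M + C + D) * (n + 1) ≤ L * ((n : ℚ) + 1) :=
          mul_le_mul_of_nonneg_right hL (by linarith)
        have h7 : 0 ≤ M * n := mul_nonneg hM0 h4
        linarith [h1.1, h2.1, h3.2]
      have h8 : k ≤ L * (n + 1) := mod_cast h5
      nlinarith
  refine ⟨max hP.toFinset.card (L + 1), fun n => ?_⟩
  refine (Set.encard_le_encard (hcover n)).trans ((Finset.encard_biUnion_le_mul _ _
    (N.ball ((L + 1) * (n + 1))).encard ?_).trans ?_)
  · intro p _
    -- For a fixed base point `p`, choosing an element carrying the germ of `x` to that of `p` is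
    -- injective in `x`.
    choose! f hf hfg using fun (x : X) (hx : x ∈ {x | x ∈ N.escapeSet s B ∧
      ∃ g ∈ N.ball ((L + 1) * (n + 1)), N.GermRel s g x p}) => hx.2
    refine Set.encard_le_encard_of_injOn (f := f) hf ?_
    intro x hx y hy hxy
    have h1 := hfg x hx
    rw [hxy] at h1
    exact GermRel.unique_left hB hs hx.1 hy.1 h1 (hfg y hy)
  · refine mul_le_mul' (mod_cast le_max_left _ _) (Set.encard_le_encard (ball_mono ?_))
    exact Nat.mul_le_mul_right _ (le_max_right _ _)

/-- The layers grow no faster than the group. -/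
theorem exists_encard_layer_le (N : NearSystem A X) :
    ∃ C : ℕ, ∀ n, (N.layer n).encard ≤ C * (N.ball (C * (n + 1))).encard + C := by
  obtain ⟨B, hB⟩ := N.exists_isExceptional
  choose! c hc using fun (s : A) (hs : s ∈ N.gens) => hB.exists_encard_escapeSet_le hs
  have hfin := hB.finite_forall_notMem_escapeSet
  set L := ∑ s ∈ N.gens_finite.toFinset, c s
  have hcL : ∀ s ∈ N.gens, c s ≤ L := fun s hs =>
    Finset.single_le_sum (f := c) (fun _ _ => Nat.zero_le _) (N.gens_finite.mem_toFinset.2 hs)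
  refine ⟨N.gens_finite.toFinset.card * L + L + hfin.toFinset.card, fun n => ?_⟩
  have hcover : N.layer n ⊆ (⋃ s ∈ N.gens_finite.toFinset, N.layer n ∩ N.escapeSet s B) ∪
      {x | ∀ s ∈ N.gens, x ∉ N.escapeSet s B} := by
    intro x hx
    by_cases h : x ∈ {x | ∀ s ∈ N.gens, x ∉ N.escapeSet s B}
    · exact Or.inr h
    · simp only [Set.mem_ofPred_eq, not_forall, not_not] at h
      obtain ⟨s, hs, h⟩ := h
      exact Or.inl (Set.mem_biUnion (N.gens_finite.mem_toFinset.2 hs) ⟨hx, h⟩)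
  refine (Set.encard_le_encard hcover).trans ((Set.encard_union_le _ _).trans
    (add_le_add ((Finset.encard_biUnion_le_mul _ _ (L * (N.ball (L * (n + 1))).encard) ?_).trans
      ?_) ?_))
  · intro s hs
    have hs' := hcL s (N.gens_finite.mem_toFinset.1 hs)
    refine (hc s (N.gens_finite.mem_toFinset.1 hs) n).trans (mul_le_mul' (mod_cast hs')
      (Set.encard_le_encard (ball_mono (Nat.mul_le_mul_right _ hs'))))
  · rw [← mul_assoc]
    refine mul_le_mul' ?_ (Set.encard_le_encard (ball_mono (Nat.mul_le_mul_right _ ?_)))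
    · norm_cast
      omega
    · omega
  · rw [hfin.encard_eq_coe_toFinset_card]
    norm_cast
    omega

end NearSystem

/-! ### From near actions of a group to near systems of an abelian subgroup -/

theorem hubLayer_mono {A X : Type*} {act : A → X → X} {S : Set A} {E : Set X} {m n : ℕ}
    (h : m ≤ n) : hubLayer act S E m ⊆ hubLayer act S E n := by
  induction n, h using Nat.le_induction with
  | base => exact subset_rfl
  | succ n _ ih => exact ih.trans fun _ hx => Or.inl hx

namespace NearAction

/-- The graph `Γ` is generated by the maps `ρ s`, for `s` in a finite set, outside a finite set. -/
def IsGeneratedGraph {G X : Type*} (ρ : G → X → X) (Γ : SimpleGraph X) : Prop :=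
  ∃ (S : Set G) (E : Set X), S.Finite ∧ E.Finite ∧
    ∀ x y, Γ.Adj x y → x ∈ E ∨ ∃ s ∈ S, ρ s x = y

theorem IsGeneratedGraph.of_isKeyFobCompletion {G X : Type*} {ρ : G → X → X}
    {Γ K : SimpleGraph X} (hΓ : IsGeneratedGraph ρ Γ) (hK : Γ.IsKeyFobCompletion K) :
    IsGeneratedGraph ρ K := by
  obtain ⟨S, E, hS, hE, h⟩ := hΓ
  obtain ⟨-, hfin, -⟩ := hK
  have hV : (⋃ e ∈ K.edgeSet \ Γ.edgeSet, {x | x ∈ e}).Finite := by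
    refine hfin.biUnion fun e _ => ?_
    induction e with
    | _ a b =>
      refine (Set.toFinite {a, b}).subset fun x hx => ?_
      simpa using hx
  refine ⟨S, E ∪ _, hS, hE.union hV, ?_⟩
  intro x y hxy
  by_cases hΓxy : Γ.Adj x y
  · exact (h x y hΓxy).imp_left Or.inl
  · exact Or.inl (Or.inr (Set.mem_biUnion (x := s(x, y)) ⟨hxy, hΓxy⟩ (Sym2.mem_mk_left x y)))

variable {G X : Type*} [Group G] {α : NearAction G X} {ρ : G → X → X}

/-- A family of self-maps of `X` which coincide with representatives of the near permutations
`α g` on cofinite subsets. -/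
structure IsLiftFamily (α : NearAction G X) (ρ : G → X → X) : Prop where
  one : ∀ x, ρ 1 x = x
  eventually_eq : ∀ g f, NearPerm.mk f = α g → ∀ᶠ x in cofinite, f.1 x = some (ρ g x)

theorem exists_rep (α : NearAction G X) (g : G) :
    ∃ f : CofinitePartialBij X, NearPerm.mk f = α g :=
  Quotient.exists_rep (α g)

theorem exists_isLiftFamily (α : NearAction G X) : ∃ ρ : G → X → X, α.IsLiftFamily ρ := by
  have h : ∀ g, ∃ r : X → X, (g = 1 → ∀ x, r x = x) ∧
      ∀ f, NearPerm.mk f = α g → ∀ᶠ x in cofinite, f.1 x = some (r x) := by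
    intro g
    -- The identity is lifted exactly, because `act_one` is required at every point. Other lifts fix
    -- the finitely many points outside the domain of a representative.
    by_cases hg : g = 1
    · refine ⟨fun x => x, fun _ _ => rfl, fun f hf => ?_⟩
      rw [hg, map_one] at hf
      exact Quotient.exact hf
    · obtain ⟨f₀, hf₀⟩ := α.exists_rep g
      refine ⟨fun x => (f₀.1 x).getD x, fun h => absurd h hg, fun f hf => ?_⟩
      have h1 : ∀ᶠ x in cofinite, f.1 x = f₀.1 x := Quotient.exact (hf.trans hf₀.symm)
      filter_upwards [h1, f₀.2.1.eventually_cofinite_notMem] with x h1 h2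
      obtain ⟨y, hy⟩ := Option.ne_none_iff_exists'.1 h2
      rw [h1, hy, Option.getD_some]
  choose ρ h1 h2 using h
  exact ⟨ρ, h1 1 rfl, h2⟩

theorem IsLiftFamily.tendsto (h : α.IsLiftFamily ρ) (g : G) :
    Tendsto (ρ g) cofinite cofinite := by
  intro U hU
  obtain ⟨f, hf⟩ := α.exists_rep g
  refine ((eventually_cofinite.1 (h.eventually_eq g f hf)).union
    (CofinitePartialBij.finite_preimage f.1 hU)).subset ?_
  intro x hx
  by_cases hfx : f.1 x = some (ρ g x)
  · exact Or.inr ⟨_, hx, hfx⟩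
  · exact Or.inl hfx

theorem IsLiftFamily.mul (h : α.IsLiftFamily ρ) (a b : G) :
    ∀ᶠ x in cofinite, ρ a (ρ b x) = ρ (a * b) x := by
  obtain ⟨f, hf⟩ := α.exists_rep a
  obtain ⟨k, hk⟩ := α.exists_rep b
  have hfk : NearPerm.mk (CofinitePartialBij.comp f k) = α (a * b) := by
    rw [map_mul, ← hf, ← hk]
    rfl
  filter_upwards [h.eventually_eq _ _ hk, h.eventually_eq _ _ hfk,
    (h.tendsto b).eventually (h.eventually_eq _ _ hf)] with x h1 h2 h3
  change (k.1 x).bind f.1 = _ at h2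
  rw [h1, Option.bind_some, h3] at h2
  exact Option.some_injective _ h2

theorem IsLiftFamily.finite_of_isCommensurated (h : α.IsLiftFamily ρ) {Y : Set X}
    (hY : α.IsCommensurated Y) (g : G) : {x | x ∈ Y ∧ ρ g x ∉ Y}.Finite := by
  obtain ⟨f, hf⟩ := α.exists_rep g
  refine ((hY g f hf).union (eventually_cofinite.1 (h.eventually_eq g f hf))).subset ?_
  rintro x ⟨hx, hgx⟩
  by_cases hfx : f.1 x = some (ρ g x)
  · exact Or.inl ⟨hx, _, hfx, hgx⟩
  · exact Or.inr hfx

/-- An edge may be traversed against its orientation, so inverses join the generators, and both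
coordinates of the finitely many wrong pairs join the exceptional set. -/
theorem IsNearSchreierGraph.isGeneratedGraph {Γ : SimpleGraph X} (hΓ : α.IsNearSchreierGraph Γ)
    (h : α.IsLiftFamily ρ) : IsGeneratedGraph ρ Γ := by
  obtain ⟨S, R, -, hR, rfl⟩ := hΓ
  have key : ∀ s ∈ S, ∃ E : Set X, E.Finite ∧
      ∀ x y, x ∉ E → (R s x y → ρ s x = y) ∧ (R s y x → ρ s⁻¹ x = y) := by
    intro s hs
    obtain ⟨f, hf, hfin⟩ := hR s hs
    have hf' : NearPerm.mk (CofinitePartialBij.inv f) = α s⁻¹ := by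
      rw [map_inv, ← hf]
      rfl
    refine ⟨_, ((hfin.image Prod.fst).union (hfin.image Prod.snd)).union
      ((eventually_cofinite.1 (h.eventually_eq _ _ hf)).union
        (eventually_cofinite.1 (h.eventually_eq _ _ hf'))), ?_⟩
    intro x y hx
    simp only [Set.mem_union, not_or, Set.mem_image, not_exists, not_and, Set.mem_ofPred_eq,
      not_not] at hx
    obtain ⟨⟨h1, h2⟩, h3, h4⟩ := hx
    constructor
    · intro hxy
      by_cases hp : R s x y ↔ f.1 x = some y
      · rw [h3] at hp
        exact Option.some_injective _ (hp.1 hxy)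
      · exact absurd rfl (h1 (x, y) hp)
    · intro hyx
      by_cases hp : R s y x ↔ f.1 y = some x
      · have h5 : f.1.symm x = some y := f.1.eq_some_iff.2 (hp.1 hyx)
        change f.1.symm x = _ at h4
        rw [h4] at h5
        exact Option.some_injective _ h5
      · exact absurd rfl (h2 (y, x) hp)
  choose! E hE hE' using key
  refine ⟨(S : Set G) ∪ (S : Set G)⁻¹, ⋃ s ∈ S, E s, S.finite_toSet.union S.finite_toSet.inv,
    S.finite_toSet.biUnion hE, ?_⟩
  rintro x y ⟨-, ⟨s, hs, hxy⟩ | ⟨s, hs, hxy⟩⟩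
  · by_cases hx : x ∈ E s
    · exact Or.inl (Set.mem_biUnion hs hx)
    · exact Or.inr ⟨s, Or.inl hs, (hE' s hs x y hx).1 hxy⟩
  · by_cases hx : x ∈ E s
    · exact Or.inl (Set.mem_biUnion hs hx)
    · exact Or.inr ⟨s⁻¹, Or.inr (by simpa using hs), (hE' s hs x y hx).2 hxy⟩

/-- Restriction to an abelian subgroup of finite index: the distance to a finite set in a graph
generated by a near action of `G` bounds the distance to the hub of a near system for the
subgroup. -/
theorem IsLiftFamily.exists_nearSystem (h : α.IsLiftFamily ρ) (hfg : Group.FG G) (A : Subgroup G)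
    [A.FiniteIndex] [IsMulCommutative A] {K : SimpleGraph X} (hK : IsGeneratedGraph ρ K)
    {Z : Set X} (hZ : Z.Finite) (hreach : ∀ x, ∃ z ∈ Z, K.Reachable x z) :
    ∃ N : NearSystem A X, (∀ a x, N.act a x = ρ a x) ∧
      ∀ x, ∀ z ∈ Z, ∀ w : K.Walk x z, x ∈ N.layer w.length := by
  obtain ⟨S, E, hS, hE, hadj⟩ := hK
  obtain ⟨⟨FA, hFA⟩⟩ : Group.FG A := A.fg_of_index_ne_zero
  let r : G ⧸ A → G := Quotient.out
  -- Including `1` makes the statement about `ρ t⁻¹ x` cover `x` itself.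
  let T : Set G := insert 1 (Set.range r)
  have hT : T.Finite := (Set.finite_range r).insert 1
  have hTA : ∀ g, ∃ t ∈ T, t⁻¹ * g ∈ A := fun g =>
    ⟨_, Or.inr ⟨(g : G ⧸ A), rfl⟩, QuotientGroup.eq.1 (Quotient.out_eq _)⟩
  let S₁ : Set A := Subtype.val ⁻¹' (T⁻¹ * S * T) ∪ FA
  have hS₁ : S₁.Finite :=
    (((hT.inv.mul hS).mul hT).preimage Subtype.val_injective.injOn).union FA.finite_toSet
  let E₁ : Set X := E ∪ ⋃ t ∈ T, ⋃ t' ∈ T, ⋃ s ∈ S, {x | ¬ (ρ t'⁻¹ (ρ s x) = ρ (t'⁻¹ * s) x ∧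
    ρ (t'⁻¹ * s * t) (ρ t⁻¹ x) = ρ (t'⁻¹ * s * t * t⁻¹) x)}
  have hE₁ : E₁.Finite := hE.union (hT.biUnion fun t _ => hT.biUnion fun t' _ =>
    hS.biUnion fun s _ => (h.mul _ _).and (h.mul _ _))
  let H : Set X := ⋃ t ∈ T, ρ t⁻¹ '' (E₁ ∪ Z)
  have hH : H.Finite := hT.biUnion fun t _ => (hE₁.union hZ).image _
  let act : A → X → X := fun a x => ρ a x
  have hwalk : ∀ x z (w : K.Walk x z), z ∈ Z → ∀ t ∈ T,
      ρ t⁻¹ x ∈ hubLayer act (S₁ ∪ S₁⁻¹) H w.length := by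
    intro x z w hz
    induction w with
    | nil => exact fun t ht => Set.mem_biUnion ht ⟨_, Or.inr hz, rfl⟩
    | @cons x y z hxy w ih =>
      intro t ht
      by_cases hx : x ∈ E₁
      · exact hubLayer_mono (Nat.zero_le _) (Set.mem_biUnion ht ⟨_, Or.inl hx, rfl⟩)
      obtain ⟨s, hs, rfl⟩ := (hadj x y hxy).resolve_left fun hc => hx (Or.inl hc)
      -- Schreier's trick: the element `t'⁻¹ * s * t` of `A` moves `ρ t⁻¹ x` to `ρ t'⁻¹ (ρ s x)`, so
      -- one edge costs one step in the subgroup.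
      obtain ⟨t', ht', hA⟩ := hTA (s * t)
      rw [← mul_assoc] at hA
      obtain ⟨h1, h2⟩ := not_not.1 fun hc => hx (Or.inr (Set.mem_biUnion ht
        (Set.mem_biUnion ht' (Set.mem_biUnion hs hc))))
      rw [mul_inv_cancel_right] at h2
      refine Or.inr ⟨⟨t'⁻¹ * s * t, hA⟩, Or.inl (Or.inl ?_), ?_⟩
      · exact Set.mul_mem_mul (Set.mul_mem_mul (Set.inv_mem_inv.2 ht') hs) ht
      · change ρ (t'⁻¹ * s * t) (ρ t⁻¹ x) ∈ _
        rw [h2, ← h1]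
        exact ih hz t' ht'
  have hwalk' : ∀ x, ∀ z ∈ Z, ∀ w : K.Walk x z, x ∈ hubLayer act (S₁ ∪ S₁⁻¹) H w.length := by
    intro x z hz w
    have := hwalk x z w hz 1 (Set.mem_insert 1 _)
    rwa [inv_one, h.one] at this
  refine ⟨{ act := act
            act_one := h.one
            act_mul := fun a b => h.mul a b
            gens := S₁ ∪ S₁⁻¹
            gens_finite := hS₁.union hS₁.inv
            inv_mem := ?_
            closure_gens := ?_
            hub := H
            hub_finite := hH
            exists_mem_layer := ?_ }, fun _ _ => rfl, hwalk'⟩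
  · rintro s (hs | hs)
    · exact Or.inr (Set.inv_mem_inv.2 hs)
    · exact Or.inl hs
  · rw [eq_top_iff, ← hFA]
    exact Subgroup.closure_mono fun s hs => Or.inl (Or.inr hs)
  · intro x
    obtain ⟨z, hz, ⟨w⟩⟩ := hreach x
    exact ⟨_, hwalk' x z hz w⟩

theorem IsFiniteType.isFinitelyEnded (hft : α.IsFiniteType) (hfg : Group.FG G) (A : Subgroup G)
    [A.FiniteIndex] [IsMulCommutative A] : α.IsFinitelyEnded := by
  obtain ⟨ρ, h⟩ := α.exists_isLiftFamily
  obtain ⟨Γ, hΓ, hcomp⟩ := hft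
  let r : Γ.ConnectedComponent → X := Quot.out
  obtain ⟨N, hN, -⟩ := h.exists_nearSystem hfg A (hΓ.isGeneratedGraph h) (Set.finite_range r) fun x =>
      ⟨_, ⟨Γ.connectedComponentMk x, rfl⟩,
        (SimpleGraph.ConnectedComponent.exact (Quot.out_eq (Γ.connectedComponentMk x))).symm⟩
  obtain ⟨P, hP, hdet⟩ := N.exists_finite_determining_set
  have hinv : ∀ Y, α.IsCommensurated Y → N.IsNearInvariant Y := fun Y hY =>
    NearSystem.IsNearInvariant.of_forall_finite fun a => by
      simpa only [hN] using h.finite_of_isCommensurated hY a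
  have := N.gens_finite.to_subtype
  have := hP.to_subtype
  -- An end class is encoded by the finite table recording which orbits of the points of `P`
  -- eventually lie in it.
  refine Finite.of_injective (β := N.gens → P → Prop)
    (fun q s p => ∀ᶠ k in atTop, (N.act s)^[k] p ∈ q.out.1) ?_
  intro q q' hq
  rw [← Quotient.out_eq q, ← Quotient.out_eq q']
  refine Quotient.sound (hdet _ _ (hinv _ q.out.2) (hinv _ q'.out.2) ?_)
  intro s hs p hp
  exact iff_of_eq (congrFun (congrFun hq ⟨s, hs⟩) ⟨p, hp⟩)

end NearAction

/-! ### Growth of a subgroup inside a Cayley graph -/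

section Cayley

variable {G : Type*} [Group G] {T : Finset G}

/-- Edges come from left multiplication, so right translations are graph homomorphisms. -/
theorem leftCayleyGraph_edist_mul_right_le (x y h : G) :
    (leftCayleyGraph T).edist (x * h) (y * h) ≤ (leftCayleyGraph T).edist x y := by
  by_cases htop : (leftCayleyGraph T).edist x y = ⊤
  · rw [htop]
    exact le_top
  obtain ⟨w, hw⟩ := SimpleGraph.exists_walk_of_edist_ne_top htop
  let f : leftCayleyGraph T →g leftCayleyGraph T :=
    { toFun := fun g => g * h
      map_rel' := by
        rintro a b ⟨hne, hor⟩
        refine ⟨fun hc => hne (mul_right_cancel hc), ?_⟩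
        exact hor.imp (fun ⟨s, hs, hab⟩ => ⟨s, hs, by rw [← mul_assoc, hab]⟩)
          (fun ⟨s, hs, hab⟩ => ⟨s, hs, by rw [← mul_assoc, hab]⟩) }
  rw [← hw, ← SimpleGraph.Walk.length_map f w]
  exact SimpleGraph.edist_le _

theorem leftCayleyGraph_edist_one_mul_le (g h : G) :
    (leftCayleyGraph T).edist 1 (g * h) ≤
      (leftCayleyGraph T).edist 1 g + (leftCayleyGraph T).edist 1 h := by
  refine ((leftCayleyGraph T).edist_triangle (v := h)).trans ?_
  rw [add_comm]
  refine add_le_add_left ?_ _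
  simpa using leftCayleyGraph_edist_mul_right_le (T := T) 1 g h

theorem leftCayleyGraph_edist_one_ne_top (hT : Subgroup.closure (T : Set G) = ⊤) (g : G) :
    (leftCayleyGraph T).edist 1 g ≠ ⊤ := by
  have hg : g ∈ Subgroup.closure (T : Set G) := by simp [hT]
  induction hg using Subgroup.closure_induction with
  | mem s hs =>
    refine ne_top_of_le_ne_top ENat.one_ne_top (SimpleGraph.edist_le_one_iff_adj_or_eq.2 ?_)
    by_cases h1 : 1 = s
    · exact Or.inr h1
    · exact Or.inl ⟨h1, Or.inl ⟨s, hs, mul_one s⟩⟩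
  | one => simp
  | mul a b _ _ ha hb =>
    exact ne_top_of_le_ne_top (WithTop.add_ne_top.2 ⟨ha, hb⟩) (leftCayleyGraph_edist_one_mul_le a b)
  | inv a _ ha =>
    refine ne_top_of_le_ne_top ha ?_
    rw [SimpleGraph.edist_comm]
    simpa using leftCayleyGraph_edist_mul_right_le (T := T) 1 a a⁻¹

/-- The growth of a subgroup with respect to finitely many of its elements is bounded by the growth
of the group. -/
theorem exists_encard_pow_le_growthFunction (hT : Subgroup.closure (T : Set G) = ⊤)
    (A : Subgroup G) {S : Set A}
    (hS : S.Finite) :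
    ∃ M : ℕ, ∀ n, (S ^ n).encard ≤ (leftCayleyGraph T).growthFunction 1 (M * n) := by
  have hM : ∃ M : ℕ, ∀ s ∈ S, (leftCayleyGraph T).edist 1 (s : G) ≤ M := by
    obtain ⟨M, hM⟩ := (hS.image fun s : A => ((leftCayleyGraph T).edist 1 (s : G)).toNat).bddAbove
    refine ⟨M, fun s hs => ?_⟩
    rw [← ENat.natCast_toNat (leftCayleyGraph_edist_one_ne_top hT (s : G))]
    exact mod_cast hM ⟨s, hs, rfl⟩
  obtain ⟨M, hM⟩ := hM
  have hpow : ∀ n : ℕ, ∀ a ∈ S ^ n, (leftCayleyGraph T).edist 1 (a : G) ≤ (M * n : ℕ) := by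
    intro n
    induction n with
    | zero =>
      intro a ha
      rw [pow_zero, Set.mem_one] at ha
      simp [ha]
    | succ n ih =>
      intro a ha
      rw [pow_succ] at ha
      obtain ⟨b, hb, s, hs, rfl⟩ := Set.mem_mul.1 ha
      refine (leftCayleyGraph_edist_one_mul_le (b : G) s).trans ?_
      rw [mul_add, mul_one, Nat.cast_add]
      exact add_le_add (ih b hb) (hM s hs)
  exact ⟨M, fun n => Set.encard_le_encard_of_injOn (f := Subtype.val) (hpow n)
    Subtype.val_injective.injOn⟩

end Cayley

/-! ### Comparison of growth functions and conclusion -/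

theorem SimpleGraph.growthFunction_mono {X : Type*} (K : SimpleGraph X) (x₀ : X) {m n : ℕ}
    (h : m ≤ n) : K.growthFunction x₀ m ≤ K.growthFunction x₀ n :=
  Set.encard_le_encard fun y (hy : K.edist x₀ y ≤ m) => hy.trans (Nat.cast_le.2 h)

theorem NearAction.asympBoundedBy {G X : Type*} [Group G] {α : NearAction G X}
    (hfg : Group.FG G) (A : Subgroup G) [A.FiniteIndex] [IsMulCommutative A] {b c : ℕ → ℕ∞}
    (hb : α.IsGrowthFunction b) (hc : IsGroupGrowthFunction G c) : AsympBoundedBy b c := by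
  obtain ⟨Γ, K, x₀, hΓ, hK, rfl⟩ := hb
  obtain ⟨T, hT, rfl⟩ := hc
  obtain ⟨ρ, h⟩ := α.exists_isLiftFamily
  have hconn := hK.2.2
  obtain ⟨N, -, hN⟩ := h.exists_nearSystem hfg A
    ((hΓ.isGeneratedGraph h).of_isKeyFobCompletion hK) (Set.finite_singleton x₀)
    fun x => ⟨x₀, rfl, hconn.preconnected x x₀⟩
  obtain ⟨C, hC⟩ := N.exists_encard_layer_le
  obtain ⟨M, hM⟩ := exists_encard_pow_le_growthFunction hT A (N.gens_finite.insert 1)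
  have hlayer : ∀ n : ℕ, {y | K.edist x₀ y ≤ n} ⊆ N.layer n := by
    intro n y (hy : K.edist x₀ y ≤ n)
    obtain ⟨w, hw⟩ := hconn.exists_walk_length_eq_edist y x₀
    refine hubLayer_mono ?_ (hN y x₀ rfl w)
    rw [SimpleGraph.edist_comm, ← hw] at hy
    exact mod_cast hy
  -- The term `2 * M * C` absorbs `n + 1 ≤ 2 * n`, valid only for `n ≥ 1`; at `n = 0` the ball is a
  -- single point and the additive constant suffices.
  refine ⟨2 * M * C + C + 1, by omega, fun n => ?_⟩
  rcases Nat.eq_zero_or_pos n with rfl | hn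
  · refine le_trans ?_ le_add_self
    have h0 : {y | K.edist x₀ y ≤ (0 : ℕ)} = {x₀} := by
      ext y
      simp [eq_comm (a := y)]
    rw [SimpleGraph.growthFunction, h0, Set.encard_singleton]
    norm_cast
    omega
  · refine (Set.encard_le_encard (hlayer n)).trans ((hC n).trans ?_)
    refine add_le_add (mul_le_mul' (mod_cast (by omega)) ((hM _).trans
      (SimpleGraph.growthFunction_mono _ _ ?_))) (mod_cast (by omega))
    calc M * (C * (n + 1)) ≤ M * (C * (2 * n)) := by gcongr; omega
      _ = 2 * M * C * n := by ring
      _ ≤ _ := Nat.mul_le_mul_right n (by omega)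

theorem mainTheorem4 {G : Type*} [Group G] (hfg : Group.FG G) (hva : IsVirtuallyAbelian G)
    {X : Type*} (α : NearAction G X) (hft : α.IsFiniteType) :
    α.IsFinitelyEnded ∧
      ∀ b c : ℕ → ℕ∞, α.IsGrowthFunction b → IsGroupGrowthFunction G c → AsympBoundedBy b c := by
  obtain ⟨A, hA, hcomm⟩ := hva
  have : IsMulCommutative A := IsMulCommutative.of_setLike_mul_comm hcomm
  exact ⟨hft.isFinitelyEnded hfg A, fun b c hb hc => NearAction.asympBoundedBy hfg A hb hc⟩
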